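/- **Theorem.** For an abelian group $G$ and a real number $t\ge 1$ let $\beta_G(t)=\max\{|H| : H\le G \text{ a finite subgroup},\ |H|\le t\}$. For real $x$ and an integer $s\ge 0$ let $\binom{x}{s}=\frac{x(x-1)\cdots(x-s+1)}{s!}$, and let $\log$ be the natural logarithm. (a) Let $n,s\ge 1$ be integers, let $K$ be a real number, let $G$ be an abelian group and let $Y\subset G$ with $|Y|=n$. If $K\ge 2$ and $K(\log n)^3<2^{-36}s$, then the number of sets $J\subset Y$ with $|J|=s$ and $|J+J|\le K|J|$ is at most $$\exp\Big(2^9\lambda K^{1/6}s^{5/6}\sqrt{\log n}\Big)\binom{\frac12(Ks+\beta)}{s},$$ where $\beta=\beta_G\big(Ks+2^6K^{7/6}s^{5/6}\sqrt{\log n}\big)$ and $\lambda=\min\big\{\frac{K}{K-2},\log s\big\}$, with $\frac{K}{K-2}$ read as $+\infty$ when $K=2$. (b) For every $\delta>0$ there is $c>0$ such that for all integers $n,s\ge1$, every real $K$, every abelian group $G$ and every $Y\subset G$ with $|Y|=n$: if $K\ge 2$ and $K(\log n)^3\le cs$, then the number of sets $J\subset Y$ with $|J|=s$ and $|J+J|\le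 K|J|$ is at most $$2^{\delta s}\binom{\frac12(Ks+\beta)}{s},\qquad \beta=\beta_G\big((1+\delta)Ks\big).$$ (c) For every $\delta>0$ there is $c>0$ such that for all integers $n,s\ge1$ and every real $K$: if $K\ge 2$ and $K(\log n)^3\le cs$, then the number of sets $J\subset\{1,\dots,n\}$ with $|J|=s$ and $|J+J|\le K|J|$ is at most $2^{\delta s}\binom{\frac12Ks}{s}$. -/

import Mathlib

open scoped Pointwise

universe u

/-- `β(t)`: the largest order of a finite subgroup of `G` of order at most `t`.
For `t ≥ 1` the set below is non-empty (trivial subgroup) and bounded, so the supremum is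
a maximum. -/
noncomputable def largestSubgroupCard (G : Type u) [AddCommGroup G] (t : ℝ) : ℕ :=
  sSup {k : ℕ | ∃ H : AddSubgroup G, Finite H ∧ Nat.card H = k ∧ (k : ℝ) ≤ t}

/-- The `s`-element subsets `J` of `Y` with `|J + J| ≤ K |J|`. -/
noncomputable def smallDoublingSets {G : Type u} [AddCommGroup G] [DecidableEq G]
    (Y : Finset G) (s : ℕ) (K : ℝ) : Finset (Finset G) :=
  (Y.powersetCard s).filter (fun J => ((J + J).card : ℝ) ≤ K * (J.card : ℝ))

/-- `λ = min {K / (K - 2), log s}`, where `K / (K - 2)` is read as `+∞` at `K = 2`. -/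
noncomputable def doublingLambda (K : ℝ) (s : ℕ) : ℝ :=
  if K = 2 then Real.log s else min (K / (K - 2)) (Real.log s)

/-! ### Dyson transforms and a Pollard inequality with a subgroup defect -/

section Pollard

variable {G : Type u} [AddCommGroup G]

/-! The proof is a container argument. Put `m = K s`. A set `J` with `|J + J| ≤ m` is tracked by a
pair `(A, B)` with `J ⊆ A` and `B ⊆ J + J`. Starting from `(Y, ∅)`, rounds of choices shrink `A` or
enlarge `B` until `|A| ≤ X = (1 + 2ε)(m + β)/2`; the `s`-subsets of such an `A` are counted by a
binomial coefficient. It remains to bound the number of choices.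

Progress comes from `supersaturation`: if `|B| ≤ m` and `|A| > X`, more than `ε²|A|²` pairs of `A`
have their sum outside `B`. This follows from `pollard_largestSubgroupCard`, a lower bound for the
truncated sums of the representation function. Dyson transforms prove it by induction; they get
stuck only when `B` lies in a coset of a finite subgroup stabilising `A`, whence the term `β`.

In a round, let `H` be the elements of `A` having many sums outside `B`. If `J` has fewer than `q`
points in `H`, these points are recorded and the rest of `H` is deleted from `A`. Otherwise `q`
points `F ⊆ J ∩ H` are recorded, with a fingerprint `T ⊆ J` such that `T + F` supplies at least
`r|T|` new elements of `J + J`. When `T` is maximal, every element of `J` has low degree towards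
`F`, and double counting shows that `A` shrinks or `B` grows. Each choice of `F` costs about `n^q`,
while all fingerprints together cost at most `n^(m/r)`, since `B` cannot outgrow `m`.

With `D = ε²` there are at most `8 log n / D` rounds. Balancing the two costs fixes `q`. Taking `ε^6
= K (log n)^3 / s` makes the total of order `exp(O(ε s))`. Elementary bounds for real binomials then
remove the factor `1 + 2ε` from the upper argument. -/

lemma bddAbove_subgroupCard (t : ℝ) :
    BddAbove {k : ℕ | ∃ H : AddSubgroup G, Finite H ∧ Nat.card H = k ∧ (k : ℝ) ≤ t} :=
  ⟨⌊t⌋₊, fun _ ⟨_, _, _, hk⟩ => Nat.le_floor hk⟩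

lemma card_le_largestSubgroupCard {H : AddSubgroup G} [Finite H] {t : ℝ}
    (h : (Nat.card H : ℝ) ≤ t) : Nat.card H ≤ largestSubgroupCard G t :=
  le_csSup (bddAbove_subgroupCard t) ⟨H, inferInstance, rfl, h⟩

lemma one_le_largestSubgroupCard {t : ℝ} (h : 1 ≤ t) : 1 ≤ largestSubgroupCard G t := by
  have := card_le_largestSubgroupCard (G := G) (H := ⊥) (t := t) (by simpa using h)
  simpa using this

lemma largestSubgroupCard_mono {t t' : ℝ} (ht : 1 ≤ t) (h : t ≤ t') :
    largestSubgroupCard G t ≤ largestSubgroupCard G t' :=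
  csSup_le_csSup (bddAbove_subgroupCard t') ⟨1, ⊥, inferInstance, by simp, by simpa using ht⟩
    fun _ ⟨H, hf, hc, hk⟩ => ⟨H, hf, hc, hk.trans h⟩

/-- If every translate of `B` meeting `A` is contained in `A`, then `A` is large or `B` is contained
in a coset of a small subgroup. -/
lemma exists_subgroup_of_translates {A B : Finset G} (hA : A.Nonempty) (hB : B.Nonempty)
    (h : ∀ e, (∃ b ∈ B, b + e ∈ A) → ∀ b ∈ B, b + e ∈ A) :
    ∃ H : AddSubgroup G, Finite H ∧ Nat.card H ≤ A.card ∧ B.card ≤ Nat.card H := by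
  obtain ⟨a₀, ha₀⟩ := hA
  obtain ⟨b₀, hb₀⟩ := hB
  -- If `a ∈ A`, translating `B` by `a - b'` makes it meet `A` at `a`, so `b - b' + a ∈ A`. Hence
  -- differences of `B` stabilise `A`.
  set H := AddAction.stabilizer G (A : Set G) with hH
  have hsub : ∀ b ∈ B, ∀ b' ∈ B, b - b' ∈ H := by
    have key : ∀ b ∈ B, ∀ b' ∈ B, ∀ a ∈ A, (b - b') + a ∈ A := by
      intro b hb b' hb' a ha
      have := h (a - b') ⟨b', hb', by simpa using ha⟩ b hb
      rwa [show b - b' + a = b + (a - b') by abel]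
    intro b hb b' hb'
    rw [hH, AddAction.mem_stabilizer_iff]
    ext y
    constructor
    · rintro ⟨a, ha, rfl⟩
      exact key b hb b' hb' a ha
    · intro hy
      exact ⟨_, key b' hb' b hb y hy, by simp only [vadd_eq_add]; abel⟩
  have hmem : ∀ x ∈ H, x + a₀ ∈ A := by
    intro x hx
    rw [hH, AddAction.mem_stabilizer_iff] at hx
    have : x +ᵥ a₀ ∈ x +ᵥ (A : Set G) := ⟨a₀, ha₀, rfl⟩
    rw [hx] at this
    exact this
  let f : H → A := fun x => ⟨x.1 + a₀, hmem x.1 x.2⟩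
  have hf : Function.Injective f := by
    intro x y hxy
    simp only [f, Subtype.mk.injEq, add_left_inj] at hxy
    exact Subtype.ext hxy
  have : Finite H := Finite.of_injective f hf
  refine ⟨H, inferInstance, ?_, ?_⟩
  · simpa using Nat.card_le_card_of_injective f hf
  · let g : B → H := fun b => ⟨b.1 - b₀, hsub b.1 b.2 b₀ hb₀⟩
    have hg : Function.Injective g := by
      intro x y hxy
      simp only [g, Subtype.mk.injEq, sub_left_inj] at hxy
      exact Subtype.ext hxy
    simpa using Nat.card_le_card_of_injective g hg

variable [DecidableEq G]

lemma addConvolution_union_left {A A' : Finset G} (h : Disjoint A A') (B : Finset G) (x : G) :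
    (A ∪ A').addConvolution B x = A.addConvolution B x + A'.addConvolution B x := by
  unfold Finset.addConvolution
  rw [Finset.union_product, Finset.filter_union, Finset.card_union_of_disjoint]
  apply Finset.disjoint_filter_filter
  exact Finset.disjoint_product.2 (Or.inl h)

lemma addConvolution_union_right (A : Finset G) {B B' : Finset G} (h : Disjoint B B') (x : G) :
    A.addConvolution (B ∪ B') x = A.addConvolution B x + A.addConvolution B' x := by
  unfold Finset.addConvolution
  rw [Finset.product_union, Finset.filter_union, Finset.card_union_of_disjoint]
  apply Finset.disjoint_filter_filter
  exact Finset.disjoint_product.2 (Or.inr h)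

/-- Moving the shift `e` to the other summand is what lets the part of `B` carried into `A` trade
places with the part removed from `A`. -/
lemma addConvolution_image_add (A B : Finset G) (e x : G) :
    (A.image (· + e)).addConvolution B x = (B.image (· + e)).addConvolution A x := by
  unfold Finset.addConvolution
  refine Finset.card_nbij' (fun p => (p.2 + e, p.1 - e)) (fun p => (p.2 + e, p.1 - e)) ?_ ?_ ?_ ?_
  · rintro ⟨a, b⟩ h
    simp only [Finset.coe_filter, Finset.mem_product, Finset.mem_image, Set.mem_ofPred_eq] at h ⊢
    obtain ⟨⟨⟨a', ha', rfl⟩, hb⟩, rfl⟩ := h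
    exact ⟨⟨⟨b, hb, rfl⟩, by simpa using ha'⟩, by abel⟩
  · rintro ⟨a, b⟩ h
    simp only [Finset.coe_filter, Finset.mem_product, Finset.mem_image, Set.mem_ofPred_eq] at h ⊢
    obtain ⟨⟨⟨a', ha', rfl⟩, hb⟩, rfl⟩ := h
    exact ⟨⟨⟨b, hb, rfl⟩, by simpa using ha'⟩, by abel⟩
  · rintro ⟨a, b⟩ h; simp
  · rintro ⟨a, b⟩ h; simp

lemma sum_addConvolution {A B Z : Finset G} (h : A + B ⊆ Z) :
    ∑ x ∈ Z, A.addConvolution B x = A.card * B.card := by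
  rw [← Finset.card_product]
  refine (Finset.card_eq_sum_card_fiberwise ?_).symm
  rintro ⟨a, b⟩ hab
  simp only [Finset.coe_product, Set.mem_prod, Finset.mem_coe] at hab
  exact h (Finset.add_mem_add hab.1 hab.2)

/-- The Dyson transform splits the representation function. -/
lemma addConvolution_dyson (A B : Finset G) (e x : G) :
    A.addConvolution B x =
      (A ∪ B.image (· + e)).addConvolution (B.filter (· + e ∈ A)) x +
      (A \ (B.filter (· + e ∈ A)).image (· + e)).addConvolution (B.filter (· + e ∉ A)) x := by
  set C := B.filter (· + e ∈ A) with hC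
  set B' := B.filter (· + e ∉ A) with hB'
  have hd : Disjoint C B' := Finset.disjoint_filter_filter_not _ _ _
  have hB : B = C ∪ B' := (Finset.filter_union_filter_not_eq _ _).symm
  have hCA : C.image (· + e) ⊆ A := by
    intro y hy
    obtain ⟨b, hb, rfl⟩ := Finset.mem_image.1 hy
    exact (Finset.mem_filter.1 hb).2
  have hdA : Disjoint A (B'.image (· + e)) := by
    rw [Finset.disjoint_left]
    intro y hy hy'
    obtain ⟨b, hb, rfl⟩ := Finset.mem_image.1 hy'
    exact (Finset.mem_filter.1 hb).2 hy
  have hU : A ∪ B.image (· + e) = A ∪ B'.image (· + e) := by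
    rw [hB, Finset.image_union, ← Finset.union_assoc, Finset.union_eq_left.2 hCA]
  have h1 : A.addConvolution B' x = (A \ C.image (· + e)).addConvolution B' x +
      (C.image (· + e)).addConvolution B' x := by
    conv_lhs => rw [← Finset.sdiff_union_of_subset hCA]
    exact addConvolution_union_left Finset.sdiff_disjoint _ _
  rw [hU, addConvolution_union_left hdA, addConvolution_image_add B' C]
  conv_lhs => rw [hB]
  rw [addConvolution_union_right _ hd, h1]
  ring

/-- A Pollard-type inequality in abelian groups. -/
theorem pollard_largestSubgroupCard (T : ℝ) (N : ℕ) :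
    ∀ (A B Z : Finset G) (t : ℕ), B.card ≤ N → t ≤ A.card → t ≤ B.card → A + B ⊆ Z →
      (t : ℝ) * min T (A.card + B.card - t - largestSubgroupCard G T) ≤
        ∑ x ∈ Z, ((min (A.addConvolution B x) t : ℕ) : ℝ) := by
  induction N using Nat.strong_induction_on with
  | _ N ih =>
  intro A B Z t hN htA htB hZ
  rcases Nat.eq_zero_or_pos t with rfl | ht
  · simp
  have hβ : (0 : ℝ) ≤ largestSubgroupCard G T := Nat.cast_nonneg _
  have ht0 : (0 : ℝ) ≤ t := Nat.cast_nonneg _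
  -- A useful shift puts some but not all of `B` inside `A`, so both pieces `C` and `B'` are
  -- non-empty and smaller than `B`.
  by_cases hex : ∃ e, (∃ b ∈ B, b + e ∈ A) ∧ ∃ b ∈ B, b + e ∉ A
  · obtain ⟨e, ⟨b₁, hb₁, hb₁A⟩, b₂, hb₂, hb₂A⟩ := hex
    have hconv := addConvolution_dyson A B e
    set C := B.filter (· + e ∈ A) with hC
    set B' := B.filter (· + e ∉ A) with hB'
    have hCB : C.card + B'.card = B.card := Finset.card_filter_add_card_filter_not _
    have hCpos : 0 < C.card := Finset.card_pos.2 ⟨b₁, Finset.mem_filter.2 ⟨hb₁, hb₁A⟩⟩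
    have hB'pos : 0 < B'.card := Finset.card_pos.2 ⟨b₂, Finset.mem_filter.2 ⟨hb₂, hb₂A⟩⟩
    have hinj : Function.Injective (· + e : G → G) := add_left_injective e
    have hCA : C.image (· + e) ⊆ A := by
      intro y hy
      obtain ⟨b, hb, rfl⟩ := Finset.mem_image.1 hy
      exact (Finset.mem_filter.1 hb).2
    have hA2 : (A \ C.image (· + e)).card + C.card = A.card := by
      rw [← Finset.card_image_of_injective C hinj]
      exact Finset.card_sdiff_add_card_eq_card hCA
    have hA1 : (A ∪ B.image (· + e)).card = A.card + B'.card := by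
      have h1 : A ∪ B.image (· + e) = A ∪ B'.image (· + e) := by
        have hB : B = C ∪ B' := (Finset.filter_union_filter_not_eq _ _).symm
        conv_lhs => rw [hB]
        rw [Finset.image_union, ← Finset.union_assoc, Finset.union_eq_left.2 hCA]
      rw [h1, Finset.card_union_of_disjoint, Finset.card_image_of_injective _ hinj]
      rw [Finset.disjoint_left]
      intro y hy hy'
      obtain ⟨b, hb, rfl⟩ := Finset.mem_image.1 hy'
      exact (Finset.mem_filter.1 hb).2 hy
    have hZ1 : (A ∪ B.image (· + e)) + C ⊆ Z := by
      intro y hy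
      obtain ⟨a, ha, c, hc, rfl⟩ := Finset.mem_add.1 hy
      obtain ⟨hcB, hcA⟩ := Finset.mem_filter.1 hc
      rcases Finset.mem_union.1 ha with ha | ha
      · exact hZ (Finset.add_mem_add ha hcB)
      · obtain ⟨b, hb, rfl⟩ := Finset.mem_image.1 ha
        have := hZ (Finset.add_mem_add hcA hb)
        rwa [show c + e + b = b + e + c by abel] at this
    have hZ2 : (A \ C.image (· + e)) + B' ⊆ Z :=
      (Finset.add_subset_add Finset.sdiff_subset (Finset.filter_subset _ _)).trans hZ
    rcases le_or_gt t C.card with htC | htC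
    -- The pair `(A ∪ (B + e), C)` has the same total size as `(A, B)`, so for `t ≤ |C|` it suffices
    -- alone.
    · have := ih C.card (by omega) (A ∪ B.image (· + e)) C Z t le_rfl (by omega) htC hZ1
      have hc : ((A ∪ B.image (· + e)).card : ℝ) + C.card = A.card + B.card := by
        rw [hA1]; push_cast [← hCB]; ring
      rw [hc] at this
      refine this.trans (Finset.sum_le_sum fun x _ => ?_)
      rw [hconv x]
      exact_mod_cast min_le_min_right _ (Nat.le_add_right _ _)
    -- For `t > |C|` the first pair never exceeds `|C|` representations, so truncation at `|C|`
    -- loses nothing and its sum is exact. The second pair is used at level `t' = t - |C|`.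
    · obtain ⟨t', ht'⟩ : ∃ t', t = C.card + t' := ⟨t - C.card, by omega⟩
      have h2 := ih B'.card (by omega) (A \ C.image (· + e)) B' Z t' le_rfl (by omega) (by omega) hZ2
      have h1 : ∑ x ∈ Z, ((min ((A ∪ B.image (· + e)).addConvolution C x) C.card : ℕ) : ℝ) =
          C.card * (A.card + B'.card) := by
        have : ∀ x ∈ Z, min ((A ∪ B.image (· + e)).addConvolution C x) C.card =
            (A ∪ B.image (· + e)).addConvolution C x := fun x _ =>
          min_eq_left Finset.addConvolution_le_card_right
        rw [← Nat.cast_sum, Finset.sum_congr rfl this, sum_addConvolution hZ1, hA1]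
        push_cast; ring
      have h3 : ∑ x ∈ Z, ((min ((A ∪ B.image (· + e)).addConvolution C x) C.card : ℕ) : ℝ) +
          ∑ x ∈ Z, ((min ((A \ C.image (· + e)).addConvolution B' x) t' : ℕ) : ℝ) ≤
          ∑ x ∈ Z, ((min (A.addConvolution B x) t : ℕ) : ℝ) := by
        rw [← Finset.sum_add_distrib]
        refine Finset.sum_le_sum fun x _ => ?_
        rw [hconv x]
        norm_cast
        omega
      refine le_trans ?_ h3
      rw [h1]
      refine le_trans ?_ (add_le_add_right h2 _)
      set β : ℝ := (largestSubgroupCard G T : ℝ)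
      have e1 : (A.card : ℝ) = (A \ C.image (· + e)).card + C.card := by exact_mod_cast hA2.symm
      have e2 : (B.card : ℝ) = C.card + B'.card := by exact_mod_cast hCB.symm
      have e3 : (t : ℝ) = C.card + t' := by exact_mod_cast ht'
      have p1 : (0 : ℝ) ≤ C.card := Nat.cast_nonneg _
      have p2 : (0 : ℝ) ≤ t' := Nat.cast_nonneg _
      rcases min_choice T (((A \ C.image (· + e)).card : ℝ) + B'.card - t' - β) with hm | hm
      · rw [hm, e3, add_mul]
        refine add_le_add (mul_le_mul_of_nonneg_left ((min_le_right _ _).trans ?_) p1)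
          (mul_le_mul_of_nonneg_left (min_le_left _ _) p2)
        rw [e2]; linarith
      · rw [hm]
        refine (mul_le_mul_of_nonneg_left (min_le_right _ _) ht0).trans ?_
        rw [e1, e2, e3]
        nlinarith [mul_nonneg p1 hβ]
  -- The transform is stuck: each translate of `B` meeting `A` lies in `A`. Then every point of `A +
  -- b₀` has at least `|B| ≥ t` representations, giving the bound `t|A|`. If the subgroup has order
  -- at most `T`, it absorbs `|B|` into `β`; otherwise `|A|` itself exceeds `T`.
  · push Not at hex
    have hA : A.Nonempty := Finset.card_pos.1 (by omega)
    have hB : B.Nonempty := Finset.card_pos.1 (by omega)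
    have hex' : ∀ e, (∃ b ∈ B, b + e ∈ A) → ∀ b ∈ B, b + e ∈ A := fun e he b hb => hex e he b hb
    obtain ⟨H, hHf, hHA, hBH⟩ := exists_subgroup_of_translates hA hB hex'
    have hle : (t : ℝ) * A.card ≤ ∑ x ∈ Z, ((min (A.addConvolution B x) t : ℕ) : ℝ) := by
      obtain ⟨b₀, hb₀⟩ := hB
      have hsub : A.image (· + b₀) ⊆ Z := by
        intro y hy
        obtain ⟨a, ha, rfl⟩ := Finset.mem_image.1 hy
        exact hZ (Finset.add_mem_add ha hb₀)
      have hc : (A.image (· + b₀)).card = A.card :=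
        Finset.card_image_of_injective _ (add_left_injective b₀)
      have : ∀ x ∈ A.image (· + b₀), ((min (A.addConvolution B x) t : ℕ) : ℝ) = t := by
        intro y hy
        obtain ⟨a, ha, rfl⟩ := Finset.mem_image.1 hy
        norm_cast
        refine min_eq_right (htB.trans ?_)
        refine Finset.card_le_card_of_injOn (fun b => (a + b₀ - b, b)) ?_ ?_
        · intro b hb
          have h1 : b + (a - b) ∈ A := by simpa using ha
          have h2 := hex' (a - b) ⟨b, hb, h1⟩ b₀ hb₀
          simp only [Finset.coe_filter, Finset.mem_product, Set.mem_ofPred_eq]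
          refine ⟨⟨?_, hb⟩, by abel⟩
          rwa [show a + b₀ - b = b₀ + (a - b) by abel]
        · intro x _ y _ hxy
          exact (Prod.mk.inj hxy).2
      calc (t : ℝ) * A.card = ∑ x ∈ A.image (· + b₀), ((min (A.addConvolution B x) t : ℕ) : ℝ) := by
            rw [Finset.sum_congr rfl this, Finset.sum_const, hc, nsmul_eq_mul, mul_comm]
        _ ≤ _ := Finset.sum_le_sum_of_subset_of_nonneg hsub fun _ _ _ => Nat.cast_nonneg _
    refine le_trans (mul_le_mul_of_nonneg_left ?_ ht0) hle
    rcases le_or_gt (Nat.card H : ℝ) T with hT | hT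
    · refine (min_le_right _ _).trans ?_
      have h1 : (B.card : ℝ) ≤ largestSubgroupCard G T := by
        exact_mod_cast hBH.trans (card_le_largestSubgroupCard hT)
      linarith
    · refine (min_le_left _ _).trans (hT.le.trans ?_)
      exact_mod_cast hHA

end Pollard

/-! ### Supersaturation of sums outside a given set -/

section Supersaturation

variable {G : Type u} [AddCommGroup G] [DecidableEq G]

lemma sum_min_addConvolution_le (A B : Finset G) (t : ℕ) :
    ∑ x ∈ A + A, min (A.addConvolution A x) t ≤
      t * B.card + ((A ×ˢ A).filter (fun p => p.1 + p.2 ∉ B)).card := by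
  have h1 : ((A ×ˢ A).filter (fun p => p.1 + p.2 ∉ B)).card =
      ∑ x ∈ (A + A).filter (· ∉ B), A.addConvolution A x := by
    have hm : Set.MapsTo (fun p : G × G => p.1 + p.2)
        ((A ×ˢ A).filter (fun p => p.1 + p.2 ∉ B) : Finset (G × G))
        ((A + A).filter (· ∉ B) : Finset G) := by
      rintro ⟨a, b⟩ hab
      simp only [Finset.coe_filter, Finset.mem_product, Set.mem_ofPred_eq] at hab ⊢
      exact ⟨Finset.add_mem_add hab.1.1 hab.1.2, hab.2⟩
    rw [Finset.card_eq_sum_card_fiberwise hm]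
    refine Finset.sum_congr rfl fun x hx => ?_
    rw [Finset.filter_filter]
    unfold Finset.addConvolution
    congr 1
    refine Finset.filter_congr fun p _ => ⟨fun h => h.2, fun h => ⟨?_, h⟩⟩
    rw [h]; exact (Finset.mem_filter.1 hx).2
  rw [h1, ← Finset.sum_filter_add_sum_filter_not (A + A) (· ∈ B)]
  refine Nat.add_le_add ?_ (Finset.sum_le_sum fun x _ => min_le_left _ _)
  calc ∑ x ∈ (A + A).filter (· ∈ B), min (A.addConvolution A x) t
      ≤ ∑ x ∈ (A + A).filter (· ∈ B), t := Finset.sum_le_sum fun x _ => min_le_right _ _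
    _ = ((A + A).filter (· ∈ B)).card * t := by rw [Finset.sum_const, smul_eq_mul]
    _ ≤ t * B.card := by
        rw [mul_comm]
        refine Nat.mul_le_mul_left _ (Finset.card_le_card fun x hx => (Finset.mem_filter.1 hx).2)

/-- A set larger than `(m + β) / 2` has many pairs whose sum avoids a given set of size `m`. -/
lemma supersaturation {m ε : ℝ} (A B : Finset G) (hm : 0 < m) (hε : 0 < ε) (hε' : ε ≤ 1 / 64)
    (hεm : 2 ≤ ε * m) (hB : (B.card : ℝ) ≤ m)
    (hA : (1 + 2 * ε) * ((m + largestSubgroupCard G (m + 64 * (ε * m))) / 2) < A.card) :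
    ε ^ 2 * (A.card : ℝ) ^ 2 < ((A ×ˢ A).filter (fun p => p.1 + p.2 ∉ B)).card := by
  by_contra! hout
  set T := m + 64 * (ε * m) with hT
  set β : ℝ := (largestSubgroupCard G T : ℝ) with hβ
  have hβ0 : 0 ≤ β := Nat.cast_nonneg _
  set a : ℝ := (A.card : ℝ) with ha
  have ham : m / 2 < a := by nlinarith [mul_nonneg hε.le hm.le, mul_nonneg hε.le hβ0]
  have ha0 : 0 < a := by linarith
  have hεa : 1 ≤ ε * a := by nlinarith
  -- At level `t ≈ ε a` an exceptional set of `ε² a²` pairs adds at most `ε a` to `m` after division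
  -- by `t`.
  set t := ⌈ε * a⌉₊ with ht
  have ht1 : ε * a ≤ t := Nat.le_ceil _
  have ht2 : (t : ℝ) < ε * a + 1 := Nat.ceil_lt_add_one (by positivity)
  have htA : t ≤ A.card := Nat.ceil_le.2 (by nlinarith)
  have h1 := pollard_largestSubgroupCard T A.card A A (A + A) t le_rfl htA htA subset_rfl
  have h2 := sum_min_addConvolution_le A B t
  have h2' : ∑ x ∈ A + A, ((min (A.addConvolution A x) t : ℕ) : ℝ) ≤
      t * m + ε ^ 2 * a ^ 2 := by
    calc ∑ x ∈ A + A, ((min (A.addConvolution A x) t : ℕ) : ℝ)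
        ≤ t * B.card + ((A ×ˢ A).filter (fun p => p.1 + p.2 ∉ B)).card := by exact_mod_cast h2
      _ ≤ _ := add_le_add (mul_le_mul_of_nonneg_left hB (Nat.cast_nonneg _)) hout
  have h3 : ε ^ 2 * a ^ 2 ≤ t * (ε * a) := by nlinarith
  have ht0 : (0 : ℝ) < t := by linarith
  have h4 : min T (a + a - t - β) ≤ m + ε * a := by
    have : (t : ℝ) * min T (a + a - t - β) ≤ t * (m + ε * a) := by linarith
    exact le_of_mul_le_mul_left this ht0
  rcases min_le_iff.1 h4 with h5 | h5
  -- When the minimum is `T`, the set `A` dwarfs `B`, and counting all `a²` pairs without truncation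
  -- already gives a contradiction.
  · have h6 : 64 * m ≤ a := by
      have : ε * (64 * m) ≤ ε * a := by linarith
      exact le_of_mul_le_mul_left this hε
    have h7 := sum_min_addConvolution_le A B A.card
    have h8 : ∑ x ∈ A + A, min (A.addConvolution A x) A.card = A.card * A.card := by
      rw [← sum_addConvolution (subset_refl (A + A))]
      exact Finset.sum_congr rfl fun x _ => min_eq_left Finset.addConvolution_le_card_right
    rw [h8] at h7
    have h9 : a * a ≤ a * B.card + ((A ×ˢ A).filter (fun p => p.1 + p.2 ∉ B)).card := by
      rw [ha]; exact_mod_cast h7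
    have h10 : a * B.card ≤ a * (a / 64) := mul_le_mul_of_nonneg_left (by linarith) ha0.le
    have h11 : ε ^ 2 ≤ 1 / 64 := by nlinarith
    nlinarith [mul_pos ha0 ha0]
  -- Here `2(1 - ε)a < m + β + 1`, while `(1 - ε)(1 + 2ε) = 1 + ε - 2ε²`. The surplus `(ε - 2ε²)m`
  -- exceeds the rounding error `1` because `ε m ≥ 2`.
  · nlinarith [mul_pos hε ha0, mul_nonneg hε.le hm.le, mul_nonneg hε.le hβ0]

end Supersaturation

/-! ### Growth of real binomial coefficients in the upper argument -/

section RealBinomial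

lemma Ring.choose_eq_prod_div (x : ℝ) (s : ℕ) :
    Ring.choose x s = (∏ i ∈ Finset.range s, (x - i)) / (s.factorial : ℝ) := by
  rw [Ring.choose_eq_smul, ← Polynomial.eval₂_smulOneHom_eq_smeval,
    Polynomial.eval₂_eq_eval_map, descPochhammer_map, descPochhammer_eval_eq_prod_range,
    smul_eq_mul, inv_mul_eq_div]

lemma Ring.choose_pos_of_le {x : ℝ} {s : ℕ} (h : (s : ℝ) ≤ x) : 0 < Ring.choose x s := by
  rw [Ring.choose_eq_prod_div]
  refine div_pos (Finset.prod_pos fun i hi => ?_) (by positivity)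
  have : (i : ℝ) < s := by exact_mod_cast Finset.mem_range.1 hi
  linarith

lemma Ring.choose_le_choose_of_le {x y : ℝ} {s : ℕ} (h : (s : ℝ) ≤ x) (hxy : x ≤ y) :
    Ring.choose x s ≤ Ring.choose y s := by
  rw [Ring.choose_eq_prod_div, Ring.choose_eq_prod_div]
  refine div_le_div_of_nonneg_right (Finset.prod_le_prod (fun i hi => ?_) fun i _ => by linarith)
    (by positivity)
  have : (i : ℝ) < s := by exact_mod_cast Finset.mem_range.1 hi
  linarith

lemma natChoose_le_ringChoose {a s : ℕ} {x : ℝ} (hs : (s : ℝ) ≤ x) (hx : (a : ℝ) ≤ x) :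
    (a.choose s : ℝ) ≤ Ring.choose x s := by
  rcases lt_or_ge a s with h | h
  · rw [Nat.choose_eq_zero_of_lt h]
    simpa using (Ring.choose_pos_of_le hs).le
  · rw [← Ring.choose_natCast]
    exact Ring.choose_le_choose_of_le (by exact_mod_cast h) hx

/-- Factor by factor, the quotient of the two binomials is the product of `1 + y / (x - i)`; the
three estimates below differ only in the choice of `g`. -/
lemma ringChoose_add_le {x y : ℝ} {s : ℕ} (hs : (s : ℝ) ≤ x) (hy : 0 ≤ y) (g : ℕ → ℝ)
    (hg : ∀ i < s, 1 + y / (x - i) ≤ Real.exp (g i)) :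
    Ring.choose (x + y) s ≤ Real.exp (∑ i ∈ Finset.range s, g i) * Ring.choose x s := by
  rw [Ring.choose_eq_prod_div, Ring.choose_eq_prod_div, ← mul_div_assoc, Real.exp_sum,
    ← Finset.prod_mul_distrib]
  refine div_le_div_of_nonneg_right (Finset.prod_le_prod (fun i hi => ?_) fun i hi => ?_)
    (by positivity)
  all_goals
    have hi' := Finset.mem_range.1 hi
    have : (i : ℝ) < s := by exact_mod_cast hi'
    have hxi : 0 < x - i := by linarith
  · linarith
  · refine le_trans (le_of_eq ?_) (mul_le_mul_of_nonneg_right (hg i hi') hxi.le)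
    field_simp
    ring

lemma one_add_le_exp_sqrt {u : ℝ} (hu : 0 ≤ u) : 1 + u ≤ Real.exp √u := by
  have h := Real.sum_le_exp_of_nonneg (Real.sqrt_nonneg u) 4
  have h2 := Real.sq_sqrt hu
  set v := √u
  have hv : 0 ≤ v := Real.sqrt_nonneg u
  simp only [Finset.sum_range_succ, Finset.sum_range_zero, Nat.factorial] at h
  norm_num at h
  nlinarith [mul_nonneg hv (sq_nonneg (v - 3 / 2))]

lemma sum_inv_sqrt_le (s : ℕ) : ∑ j ∈ Finset.range s, 1 / √((j : ℝ) + 1) ≤ 2 * √s := by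
  induction s with
  | zero => simp
  | succ k ih =>
    rw [Finset.sum_range_succ]
    have h1 : 0 < √((k : ℝ) + 1) := Real.sqrt_pos.2 (by positivity)
    have h2 := Real.sq_sqrt (by positivity : (0 : ℝ) ≤ (k : ℝ) + 1)
    have h3 := Real.sq_sqrt (by positivity : (0 : ℝ) ≤ (k : ℝ))
    have h4 : 1 / √((k : ℝ) + 1) ≤ 2 * √((k : ℝ) + 1) - 2 * √k := by
      rw [div_le_iff₀ h1]
      nlinarith [sq_nonneg (√((k : ℝ) + 1) - √k)]
    push_cast
    linarith

lemma div_sub_le_div_sub {x : ℝ} {s i : ℕ} (hs : (s : ℝ) ≤ x) (hi : i < s) :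
    x / (x - i) ≤ s / (s - i) := by
  have : (i : ℝ) < s := by exact_mod_cast hi
  have h0 : (0 : ℝ) ≤ i := Nat.cast_nonneg _
  rw [div_le_div_iff₀ (by linarith) (by linarith)]
  nlinarith

/-- Increasing the upper argument by `y` costs at most a factor `exp (2 s √(y / x))`. -/
lemma ringChoose_add_le_exp_sqrt {x y : ℝ} {s : ℕ} (hs : (s : ℝ) ≤ x) (hs1 : 1 ≤ s)
    (hy : 0 ≤ y) :
    Ring.choose (x + y) s ≤ Real.exp (2 * s * √(y / x)) * Ring.choose x s := by
  have hs0 : (0 : ℝ) < s := by exact_mod_cast hs1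
  have hx : 0 < x := by linarith
  have h := ringChoose_add_le hs hy
    -- From `x / (x - i) ≤ s / (s - i)` and `1 + u ≤ exp √u`. The square root makes the sum over `i`
    -- linear in `s` even at `x = s`, where the harmonic sum would lose a logarithm.
    (fun i => √(y / x) * (√s * (1 / √((s - 1 - i : ℕ) + 1 : ℝ)))) ?_
  · refine h.trans (mul_le_mul_of_nonneg_right (Real.exp_le_exp.2 ?_)
      (Ring.choose_pos_of_le hs).le)
    rw [← Finset.mul_sum, ← Finset.mul_sum,
      Finset.sum_range_reflect (fun j => 1 / √((j : ℝ) + 1)) s]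
    have h1 := mul_le_mul_of_nonneg_left (sum_inv_sqrt_le s) (Real.sqrt_nonneg (s : ℝ))
    have h2 := Real.mul_self_sqrt hs0.le
    have h3 : √(s : ℝ) * ∑ j ∈ Finset.range s, 1 / √((j : ℝ) + 1) ≤ 2 * s := by nlinarith
    calc _ ≤ √(y / x) * (2 * s) := mul_le_mul_of_nonneg_left h3 (Real.sqrt_nonneg _)
      _ = _ := by ring
  · intro i hi
    have hi' : (i : ℝ) < s := by exact_mod_cast hi
    have hxi : 0 < x - i := by linarith
    refine (one_add_le_exp_sqrt (by positivity)).trans (Real.exp_le_exp.2 ?_)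
    have h1 : ((s - 1 - i : ℕ) + 1 : ℝ) = s - i := by
      have : (s - 1 - i : ℕ) + 1 + i = s := by omega
      have : (((s - 1 - i : ℕ) : ℝ)) + 1 + i = s := by exact_mod_cast this
      linarith
    rw [h1, mul_one_div, ← Real.sqrt_div hs0.le, ← Real.sqrt_mul (by positivity)]
    refine Real.sqrt_le_sqrt ?_
    calc y / (x - i) = y / x * (x / (x - i)) := by field_simp
      _ ≤ _ := mul_le_mul_of_nonneg_left (div_sub_le_div_sub hs hi) (by positivity)

/-- Scaling the upper argument by `1 + u` costs at most a factor `exp (u s x / (x - s))`. -/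
lemma ringChoose_mul_le_exp_div {x u : ℝ} {s : ℕ} (hs : (s : ℝ) < x) (hu : 0 ≤ u) :
    Ring.choose (x + u * x) s ≤ Real.exp (u * s * (x / (x - s))) * Ring.choose x s := by
  have hs0 : (0 : ℝ) ≤ s := Nat.cast_nonneg _
  have h := ringChoose_add_le (y := u * x) hs.le (mul_nonneg hu (by linarith)) (fun _ => u * (x / (x - s))) ?_
  · refine h.trans (le_of_eq ?_)
    rw [Finset.sum_const, Finset.card_range, nsmul_eq_mul]
    congr 2; ring
  · intro i hi
    have hi' : (i : ℝ) < s := by exact_mod_cast hi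
    rw [add_comm]
    refine le_trans (add_le_add_left ?_ _) (Real.add_one_le_exp _)
    rw [mul_div_assoc]
    refine mul_le_mul_of_nonneg_left (div_le_div_of_nonneg_left ?_ ?_ ?_) hu <;> linarith

/-- Scaling the upper argument by `1 + u` costs at most a factor `exp (u s (1 + log s))`. -/
lemma ringChoose_mul_le_exp_log {x u : ℝ} {s : ℕ} (hs : (s : ℝ) ≤ x) (hu : 0 ≤ u) :
    Ring.choose (x + u * x) s ≤ Real.exp (u * s * (1 + Real.log s)) * Ring.choose x s := by
  have hs0 : (0 : ℝ) ≤ s := Nat.cast_nonneg _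
  have h := ringChoose_add_le (y := u * x) hs (mul_nonneg hu (by linarith))
    (fun i => u * (s * ((s - 1 - i : ℕ) + 1 : ℝ)⁻¹)) ?_
  · refine h.trans (mul_le_mul_of_nonneg_right (Real.exp_le_exp.2 ?_)
      (Ring.choose_pos_of_le hs).le)
    rw [← Finset.mul_sum, ← Finset.mul_sum,
      Finset.sum_range_reflect (fun j => ((j : ℝ) + 1)⁻¹) s, mul_assoc]
    have := harmonic_le_one_add_log s
    simp only [harmonic] at this
    push_cast at this
    exact mul_le_mul_of_nonneg_left (mul_le_mul_of_nonneg_left this hs0) hu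
  · intro i hi
    have hi' : (i : ℝ) < s := by exact_mod_cast hi
    have h1 : ((s - 1 - i : ℕ) + 1 : ℝ) = s - i := by
      have : (s - 1 - i : ℕ) + 1 + i = s := by omega
      have : (((s - 1 - i : ℕ) : ℝ)) + 1 + i = s := by exact_mod_cast this
      linarith
    rw [add_comm, h1]
    refine le_trans (add_le_add_left ?_ _) (Real.add_one_le_exp _)
    rw [mul_div_assoc, ← div_eq_mul_inv]
    exact mul_le_mul_of_nonneg_left (div_sub_le_div_sub hs hi) hu

end RealBinomial

/-! ### The container algorithm -/

section Counting

/-- The number of rounds of the container algorithm that the pair `(A, B)` may still need. -/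
noncomputable def roundPotential {G : Type*} (A B : Finset G) (X m D : ℝ) : ℝ :=
  8 / D * Real.log (A.card / X) + (m - B.card) * (8 / (D * m))

/-- Shrinking `A` by `1 - D/8` lowers the logarithmic term by at least `1`. Enlarging `B` by `D|A|/4
≥ D m/8`, valid as `|A| > X ≥ m/2`, lowers the linear term by at least `1`. -/
lemma roundPotential_le_sub_one {G : Type*} {A A' B B' : Finset G} {X m D : ℝ} (hD : 0 < D)
    (hm : 0 < m) (hmX : m ≤ 2 * X) (hXA : X < A.card) (hXA' : X < A'.card) (hA : A' ⊆ A)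
    (hB : B ⊆ B')
    (h : (A'.card : ℝ) ≤ (1 - D / 8) * A.card ∨ B.card + D / 4 * A.card ≤ (B'.card : ℝ)) :
    roundPotential A' B' X m D ≤ roundPotential A B X m D - 1 := by
  have hX : 0 < X := by linarith
  have hA0 : (0 : ℝ) < A.card := by linarith
  have hA'0 : (0 : ℝ) < A'.card := by linarith
  have hBB : (B.card : ℝ) ≤ B'.card := by exact_mod_cast Finset.card_le_card hB
  have hAA : (A'.card : ℝ) ≤ A.card := by exact_mod_cast Finset.card_le_card hA
  unfold roundPotential
  rw [Real.log_div hA0.ne' hX.ne', Real.log_div hA'0.ne' hX.ne']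
  have h8 : 0 < 8 / D := by positivity
  have h8m : 0 < 8 / (D * m) := by positivity
  rcases h with h | h
  · have h1 : Real.log A'.card ≤ Real.log A.card - D / 8 := by
      have h2 : (A'.card : ℝ) ≤ Real.exp (-(D / 8)) * A.card := by
        refine h.trans (mul_le_mul_of_nonneg_right ?_ hA0.le)
        have := Real.add_one_le_exp (-(D / 8))
        linarith
      have h3 := Real.log_le_log hA'0 h2
      rw [Real.log_mul (Real.exp_ne_zero _) hA0.ne', Real.log_exp] at h3
      linarith
    have h2 : 8 / D * (Real.log A'.card - Real.log X) ≤
        8 / D * (Real.log A.card - Real.log X) - 1 := by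
      have : 8 / D * (D / 8) = 1 := by field_simp
      nlinarith
    have h3 : (m - B'.card) * (8 / (D * m)) ≤ (m - B.card) * (8 / (D * m)) :=
      mul_le_mul_of_nonneg_right (by linarith) h8m.le
    linarith
  · have h1 : 8 / D * (Real.log A'.card - Real.log X) ≤ 8 / D * (Real.log A.card - Real.log X) :=
      mul_le_mul_of_nonneg_left (sub_le_sub_right (Real.log_le_log hA'0 hAA) _) h8.le
    have h2 : (m - B'.card) * (8 / (D * m)) ≤ (m - B.card) * (8 / (D * m)) - 1 := by
      have h3 : D * m / 8 * (8 / (D * m)) = 1 := by field_simp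
      have h4 : D * m / 8 ≤ B'.card - B.card := by nlinarith
      nlinarith
    linarith

variable {G : Type u} [AddCommGroup G] [DecidableEq G]

/-- The `s`-subsets `J` of `A` with `B ⊆ J + J` and `|J + J| ≤ m`. -/
noncomputable def sandwichedSets (A B : Finset G) (s : ℕ) (m : ℝ) : Finset (Finset G) :=
  (A.powersetCard s).filter (fun J => B ⊆ J + J ∧ ((J + J).card : ℝ) ≤ m)

lemma mem_sandwichedSets {A B J : Finset G} {s : ℕ} {m : ℝ} :
    J ∈ sandwichedSets A B s m ↔
      (J ⊆ A ∧ J.card = s) ∧ B ⊆ J + J ∧ ((J + J).card : ℝ) ≤ m := by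
  rw [sandwichedSets, Finset.mem_filter, Finset.mem_powersetCard]

/-- The elements of `A` forming at least `d` sums outside `B` with elements of `A`. -/
noncomputable def highDegree (A B : Finset G) (d : ℝ) : Finset G :=
  A.filter (fun f => d ≤ (A.filter (fun a => f + a ∉ B)).card)

/-- The elements of `A` forming fewer than `r` sums outside `B` with elements of `F`. -/
noncomputable def lowDegree (A F B : Finset G) (r : ℝ) : Finset G :=
  A.filter (fun a => ((({a} + F) \ B).card : ℝ) < r)

lemma le_card_highDegree {A B : Finset G} {D : ℝ} (hA : A.Nonempty)
    (h : D * (A.card : ℝ) ^ 2 < ((A ×ˢ A).filter (fun p => p.1 + p.2 ∉ B)).card)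
    (hD : 0 ≤ D) :
    D / 2 * A.card ≤ (highDegree A B (D / 2 * A.card)).card := by
  have hA0 : (0 : ℝ) < A.card := by exact_mod_cast hA.card_pos
  have h1 : ((A ×ˢ A).filter (fun p => p.1 + p.2 ∉ B)).card =
      ∑ f ∈ A, (A.filter (fun a => f + a ∉ B)).card := by
    simp only [Finset.card_filter]
    rw [Finset.sum_product]
  set H := highDegree A B (D / 2 * A.card) with hH
  have h2 : ∑ f ∈ A, ((A.filter (fun a => f + a ∉ B)).card : ℝ) ≤
      ∑ f ∈ A, ((if f ∈ H then (A.card : ℝ) else 0) + D / 2 * A.card) := by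
    refine Finset.sum_le_sum fun f hf => ?_
    have hnn : 0 ≤ D / 2 * A.card := by positivity
    split_ifs with hfH
    · have : ((A.filter (fun a => f + a ∉ B)).card : ℝ) ≤ A.card := by
        exact_mod_cast Finset.card_filter_le _ _
      linarith
    · have : ¬ D / 2 * A.card ≤ (A.filter (fun a => f + a ∉ B)).card := fun hle =>
        hfH (Finset.mem_filter.2 ⟨hf, hle⟩)
      linarith
  have h3 : ∑ f ∈ A, ((if f ∈ H then (A.card : ℝ) else 0) + D / 2 * A.card) =
      H.card * A.card + A.card * (D / 2 * A.card) := by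
    rw [Finset.sum_add_distrib, ← Finset.sum_filter, Finset.sum_const, Finset.sum_const,
      nsmul_eq_mul, nsmul_eq_mul, Finset.filter_mem_eq_inter,
      Finset.inter_eq_right.2 (hH ▸ Finset.filter_subset _ _)]
  rw [h1] at h
  push_cast at h
  have h4 : D / 2 * A.card * A.card ≤ H.card * (A.card : ℝ) := by nlinarith
  exact le_of_mul_le_mul_right h4 hA0

/-- If `F` consists of elements of high degree, then either few elements have low degree towards
`F` relative to `B'`, or `B'` is much larger than `B`. -/
lemma card_mul_degree_le {A B B' F : Finset G} {d r : ℝ} (hr : 0 ≤ r)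
    (hF : F ⊆ highDegree A B d) :
    F.card * d ≤ r * A.card + F.card * ((A.card : ℝ) - (lowDegree A F B' r).card) +
      F.card * ((B' \ B).card : ℝ) := by
  set A' := lowDegree A F B' r with hA'
  have hA'A : A' ⊆ A := Finset.filter_subset _ _
  have h1 : F.card * d ≤ ∑ f ∈ F, ((A.filter (fun a => f + a ∉ B)).card : ℝ) := by
    rw [← nsmul_eq_mul]
    exact Finset.card_nsmul_le_sum _ _ _ fun f hf => (Finset.mem_filter.1 (hF hf)).2
  have h2 : ∀ f ∈ F, ((A.filter (fun a => f + a ∉ B)).card : ℝ) ≤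
      (A'.filter (fun a => f + a ∉ B')).card + ((A.card : ℝ) - A'.card) + (B' \ B).card := by
    intro f _
    -- A sum `f + a` outside `B` either stays outside `B'` with `a ∈ A'`, or has `a` discarded from
    -- `A`, or lies in `B' \ B`. The first kind is counted from the side of `a`, where the low
    -- degree bounds it.
    have hs : A.filter (fun a => f + a ∉ B) ⊆ A'.filter (fun a => f + a ∉ B') ∪ (A \ A') ∪
        (B' \ B).image (fun c => c - f) := by
      intro a ha
      obtain ⟨haA, haB⟩ := Finset.mem_filter.1 ha
      by_cases hb : f + a ∈ B'
      · refine Finset.mem_union_right _ (Finset.mem_image.2 ⟨f + a, ?_, by abel⟩)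
        exact Finset.mem_sdiff.2 ⟨hb, haB⟩
      · refine Finset.mem_union_left _ ?_
        by_cases haA' : a ∈ A'
        · exact Finset.mem_union_left _ (Finset.mem_filter.2 ⟨haA', hb⟩)
        · exact Finset.mem_union_right _ (Finset.mem_sdiff.2 ⟨haA, haA'⟩)
    have h3 := (Finset.card_le_card hs).trans (Finset.card_union_le _ _)
    have h4 := Finset.card_union_le (A'.filter (fun a => f + a ∉ B')) (A \ A')
    have h5 : ((B' \ B).image (fun c => c - f)).card ≤ (B' \ B).card := Finset.card_image_le
    have h6 : ((A \ A').card : ℝ) + A'.card = A.card := by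
      exact_mod_cast Finset.card_sdiff_add_card_eq_card hA'A
    have h7 : ((A.filter (fun a => f + a ∉ B)).card : ℝ) ≤
      (A'.filter (fun a => f + a ∉ B')).card + (A \ A').card + (B' \ B).card := by
      exact_mod_cast (by omega : (A.filter (fun a => f + a ∉ B)).card ≤
        (A'.filter (fun a => f + a ∉ B')).card + (A \ A').card + (B' \ B).card)
    linarith
  have h3 : ∑ f ∈ F, (A'.filter (fun a => f + a ∉ B')).card =
      ∑ a ∈ A', (({a} + F) \ B').card := by
    have : ∀ a ∈ A', (({a} + F) \ B').card = (F.filter (fun f => f + a ∉ B')).card := by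
      intro a _
      have hsing : {a} + F = F.image (a + ·) := by
        ext x; simp only [Finset.mem_add, Finset.mem_singleton, exists_eq_left, Finset.mem_image]
      rw [hsing, ← Finset.filter_notMem_eq_sdiff, Finset.filter_image,
        Finset.card_image_of_injective _ (add_right_injective a)]
      simp only [add_comm a]
    rw [Finset.sum_congr rfl this]
    simp only [Finset.card_filter]
    exact Finset.sum_comm
  have h4 : ∑ f ∈ F, ((A'.filter (fun a => f + a ∉ B')).card : ℝ) ≤ r * A.card := by
    calc ∑ f ∈ F, ((A'.filter (fun a => f + a ∉ B')).card : ℝ)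
        = ∑ a ∈ A', ((({a} + F) \ B').card : ℝ) := by exact_mod_cast h3
      _ ≤ ∑ a ∈ A', r := Finset.sum_le_sum fun a ha => (Finset.mem_filter.1 ha).2.le
      _ = A'.card * r := by rw [Finset.sum_const, nsmul_eq_mul]
      _ ≤ r * A.card := by
          rw [mul_comm]
          exact mul_le_mul_of_nonneg_left (by exact_mod_cast Finset.card_le_card hA'A) hr
  calc _ ≤ _ := h1
    _ ≤ _ := Finset.sum_le_sum h2
    _ = ∑ f ∈ F, ((A'.filter (fun a => f + a ∉ B')).card : ℝ) +
          F.card * ((A.card : ℝ) - A'.card) + F.card * ((B' \ B).card : ℝ) := by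
        rw [Finset.sum_add_distrib, Finset.sum_add_distrib, Finset.sum_const, Finset.sum_const,
          nsmul_eq_mul, nsmul_eq_mul]
    _ ≤ _ := by linarith

/-- Every `F ⊆ J` has a fingerprint `T ⊆ J` after which all elements of `J` have low degree. -/
lemma exists_fingerprint (J F B : Finset G) {r : ℝ} (hr : 0 < r) :
    ∃ T ⊆ J, r * T.card ≤ ((T + F) \ B).card ∧
      ∀ a ∈ J, ((({a} + F) \ (B ∪ (T + F))).card : ℝ) < r := by
  -- Take `T` of maximal size: an element of `J` still contributing `r` new sums could be adjoined
  -- to it.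
  obtain ⟨T, hT, hmax⟩ := Finset.exists_max_image
    (J.powerset.filter fun T => r * T.card ≤ ((T + F) \ B).card) Finset.card
    ⟨∅, by simp⟩
  obtain ⟨hTJ, hTr⟩ := Finset.mem_filter.1 hT
  rw [Finset.mem_powerset] at hTJ
  refine ⟨T, hTJ, hTr, fun a ha => ?_⟩
  by_contra! hge
  have haT : a ∉ T := by
    intro haT
    have : ({a} + F) \ (B ∪ (T + F)) = ∅ := by
      rw [Finset.sdiff_eq_empty_iff_subset]
      exact (Finset.add_subset_add_right (Finset.singleton_subset_iff.2 haT)).trans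
        Finset.subset_union_right
    rw [this] at hge
    simp at hge
    linarith
  have hins : (insert a T + F) \ B = (({a} + F) \ (B ∪ (T + F))) ∪ ((T + F) \ B) := by
    rw [Finset.insert_eq, Finset.union_add]
    ext x
    simp only [Finset.mem_sdiff, Finset.mem_union]
    tauto
  have hdisj : Disjoint (({a} + F) \ (B ∪ (T + F))) ((T + F) \ B) := by
    rw [Finset.disjoint_left]
    intro x hx hx'
    simp only [Finset.mem_sdiff, Finset.mem_union] at hx hx'
    tauto
  have := hmax (insert a T) (Finset.mem_filter.2 ⟨Finset.mem_powerset.2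
    (Finset.insert_subset ha hTJ), ?_⟩)
  · rw [Finset.card_insert_of_notMem haT] at this
    omega
  · rw [hins, Finset.card_union_of_disjoint hdisj, Finset.card_insert_of_notMem haT]
    push_cast
    linarith

/-- The families into which one round of the container algorithm splits `sandwichedSets A B s m`,
indexed by a set `F` of at most `q` elements of high degree. -/
noncomputable def roundFamily (A B : Finset G) (s : ℕ) (m : ℝ) (H : Finset G) (q : ℕ) (r : ℝ)
    (F : Finset G) : Finset (Finset G) :=
  if F.card < q then sandwichedSets ((A \ H) ∪ F) B s m
  else (A.powerset.filter fun T => r * T.card ≤ ((T + F) \ B).card).biUnion fun T =>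
    sandwichedSets (lowDegree A F (B ∪ (T + F)) r) (B ∪ (T + F)) s m

lemma sandwichedSets_subset_biUnion (A B : Finset G) (s : ℕ) (m : ℝ) (H : Finset G) (q : ℕ)
    {r : ℝ} (hr : 0 < r) :
    sandwichedSets A B s m ⊆ (H.powerset.filter fun F => F.card ≤ q).biUnion
      (roundFamily A B s m H q r) := by
  intro J hJ
  obtain ⟨⟨hJA, hJs⟩, hBJ, hJm⟩ := mem_sandwichedSets.1 hJ
  rw [Finset.mem_biUnion]
  rcases lt_or_ge (J ∩ H).card q with hq | hq
  · refine ⟨J ∩ H, Finset.mem_filter.2 ⟨Finset.mem_powerset.2 Finset.inter_subset_right, hq.le⟩, ?_⟩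
    rw [roundFamily, if_pos hq, mem_sandwichedSets]
    refine ⟨⟨fun x hx => ?_, hJs⟩, hBJ, hJm⟩
    have := hJA hx
    simp only [Finset.mem_union, Finset.mem_sdiff, Finset.mem_inter]
    tauto
  · obtain ⟨F, hF, hFq⟩ := Finset.exists_subset_card_eq hq
    refine ⟨F, Finset.mem_filter.2 ⟨Finset.mem_powerset.2 (hF.trans Finset.inter_subset_right),
      hFq.le⟩, ?_⟩
    rw [roundFamily, if_neg (by omega), Finset.mem_biUnion]
    obtain ⟨T, hTJ, hTr, hT⟩ := exists_fingerprint J F B hr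
    refine ⟨T, Finset.mem_filter.2 ⟨Finset.mem_powerset.2 (hTJ.trans hJA), hTr⟩, ?_⟩
    rw [mem_sandwichedSets]
    refine ⟨⟨fun a ha => Finset.mem_filter.2 ⟨hJA ha, hT a ha⟩, hJs⟩, ?_, hJm⟩
    exact Finset.union_subset hBJ (Finset.add_subset_add hTJ (hF.trans Finset.inter_subset_left))

/-- The weight `n^(-|T|)` makes the sum over all possible fingerprints cost only a constant factor;
the weight is paid for by the growth of `B`. -/
lemma sum_powerset_inv_pow_le {α : Type*} (A : Finset α) {n : ℕ} (hn : 1 ≤ n)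
    (hA : A.card ≤ n) : ∑ T ∈ A.powerset, ((n : ℝ)⁻¹) ^ T.card ≤ Real.exp 1 := by
  have h := Finset.sum_pow_mul_eq_add_pow ((n : ℝ)⁻¹) 1 A
  simp only [one_pow, mul_one] at h
  have hn0 : (0 : ℝ) < n := by exact_mod_cast hn
  rw [h]
  calc ((n : ℝ)⁻¹ + 1) ^ A.card ≤ (Real.exp (n : ℝ)⁻¹) ^ A.card :=
        pow_le_pow_left₀ (by positivity) (Real.add_one_le_exp _) _
    _ = Real.exp (A.card * (n : ℝ)⁻¹) := (Real.exp_nat_mul _ _).symm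
    _ ≤ Real.exp 1 := by
        rw [Real.exp_le_exp, ← div_eq_mul_inv, div_le_one hn0]
        exact_mod_cast hA

lemma card_powerset_filter_le {α : Type*} (A : Finset α) {n : ℕ} (hn : 1 ≤ n)
    (hA : A.card ≤ n) (q : ℕ) :
    ((A.powerset.filter fun F => F.card ≤ q).card : ℝ) ≤ Real.exp 1 * (n : ℝ) ^ q := by
  have hn1 : (1 : ℝ) ≤ n := by exact_mod_cast hn
  have hn0 : (0 : ℝ) < n := by linarith
  calc ((A.powerset.filter fun F => F.card ≤ q).card : ℝ)
      = ∑ F ∈ A.powerset.filter fun F => F.card ≤ q, (1 : ℝ) := by simp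
    _ ≤ ∑ F ∈ A.powerset.filter fun F => F.card ≤ q, (n : ℝ)⁻¹ ^ F.card * (n : ℝ) ^ q := by
        refine Finset.sum_le_sum fun F hF => ?_
        have := pow_le_pow_right₀ hn1 (Finset.mem_filter.1 hF).2
        rw [inv_pow, inv_mul_eq_div, one_le_div (by positivity)]
        exact this
    _ ≤ ∑ F ∈ A.powerset, (n : ℝ)⁻¹ ^ F.card * (n : ℝ) ^ q :=
        Finset.sum_le_sum_of_subset_of_nonneg (Finset.filter_subset _ _)
          fun _ _ _ => by positivity
    _ ≤ _ := by
        rw [← Finset.sum_mul]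
        exact mul_le_mul_of_nonneg_right (sum_powerset_inv_pow_le A hn hA) (by positivity)

/-- Counting sets of bounded sumset by iterating a supersaturation hypothesis. -/
theorem card_sandwichedSets_le {n s q : ℕ} {X m D M : ℝ} (hn : 1 ≤ n) (hq : 1 ≤ q) (hD : 0 < D)
    (hm : 0 < m) (hmX : m ≤ 2 * X) (hqX : (q : ℝ) ≤ D / 4 * X) (hM : 0 ≤ M)
    (hsat : ∀ A B : Finset G, (B.card : ℝ) ≤ m → X < A.card →
      D * (A.card : ℝ) ^ 2 < ((A ×ˢ A).filter (fun p => p.1 + p.2 ∉ B)).card)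
    (hleaf : ∀ a : ℕ, (a : ℝ) ≤ X → (a.choose s : ℝ) ≤ M) (ρ : ℕ) :
    ∀ A B : Finset G, A.card ≤ n → ((A.card : ℝ) ≤ X ∨ roundPotential A B X m D ≤ ρ) →
      ((sandwichedSets A B s m).card : ℝ) ≤
        (M * (Real.exp 1 * Real.exp 1 * (n : ℝ) ^ q) ^ ρ) *
          (n : ℝ) ^ ((m - B.card) / (D * q / 8)) := by
  have hn1 : (1 : ℝ) ≤ n := by exact_mod_cast hn
  have hn0 : (0 : ℝ) < n := by linarith
  have hq0 : (0 : ℝ) < q := by exact_mod_cast hq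
  have hX : 0 < X := by linarith
  -- With this threshold the low-degree pairs number at most `q · D|A|/8`, a quarter of the `q ·
  -- D|A|/2` guaranteed by high degree.
  set r := D * q / 8 with hr
  have hr0 : 0 < r := by positivity
  have hE : 1 ≤ Real.exp 1 * Real.exp 1 * (n : ℝ) ^ q := by
    have h1 : 1 ≤ Real.exp 1 := Real.one_le_exp zero_le_one
    exact one_le_mul_of_one_le_of_one_le (one_le_mul_of_one_le_of_one_le h1 h1)
      (one_le_pow₀ hn1)
  have main : ∀ (ρ : ℕ) (A B : Finset G), A.card ≤ n → (B.card : ℝ) ≤ m → (A.card : ℝ) ≤ X →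
      ((sandwichedSets A B s m).card : ℝ) ≤
        (M * (Real.exp 1 * Real.exp 1 * (n : ℝ) ^ q) ^ ρ) * (n : ℝ) ^ ((m - B.card) / r) := by
    intro ρ A B hAn hB hAX
    have h1 : ((sandwichedSets A B s m).card : ℝ) ≤ M := by
      refine le_trans ?_ (hleaf _ hAX)
      rw [← Finset.card_powersetCard]
      exact_mod_cast Finset.card_le_card (Finset.filter_subset _ _)
    have h2 : 1 ≤ (n : ℝ) ^ ((m - B.card) / r) :=
      Real.one_le_rpow hn1 (div_nonneg (by linarith) hr0.le)
    have h3 : M ≤ M * (Real.exp 1 * Real.exp 1 * (n : ℝ) ^ q) ^ ρ :=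
      le_mul_of_one_le_right hM (one_le_pow₀ hE)
    exact h1.trans (h3.trans (le_mul_of_one_le_right (hM.trans h3) h2))
  have hempty : ∀ A B : Finset G, m < B.card → (sandwichedSets A B s m).card = 0 := by
    intro A B hB
    rw [Finset.card_eq_zero, Finset.eq_empty_iff_forall_notMem]
    intro J hJ
    obtain ⟨_, hBJ, hJm⟩ := mem_sandwichedSets.1 hJ
    have : (B.card : ℝ) ≤ (J + J).card := by exact_mod_cast Finset.card_le_card hBJ
    linarith
  have hnonneg : ∀ (ρ : ℕ) (B : Finset G), 0 ≤
      (M * (Real.exp 1 * Real.exp 1 * (n : ℝ) ^ q) ^ ρ) * (n : ℝ) ^ ((m - B.card) / r) := by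
    intro ρ B; positivity
  induction ρ with
  | zero =>
    intro A B hAn h
    rcases lt_or_ge m (B.card : ℝ) with hB | hB
    · rw [hempty A B hB]; simpa using hnonneg 0 B
    · rcases le_or_gt (A.card : ℝ) X with hAX | hAX
      · exact main 0 A B hAn hB hAX
      -- A pair with `|A| > X` and `|B| ≤ m` has positive potential, so no rounds remain only at a
      -- leaf.
      · exfalso
        have h1 := h.resolve_left (not_le.2 hAX)
        unfold roundPotential at h1
        have h2 : 0 < Real.log (A.card / X) := Real.log_pos ((one_lt_div hX).2 hAX)
        have h3 : 0 ≤ (m - B.card) * (8 / (D * m)) :=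
          mul_nonneg (by linarith) (by positivity)
        have h4 : 0 < 8 / D * Real.log (A.card / X) := by positivity
        simp only [Nat.cast_zero] at h1
        linarith
  | succ ρ ih =>
    intro A B hAn h
    rcases lt_or_ge m (B.card : ℝ) with hB | hB
    · rw [hempty A B hB]; simpa using hnonneg (ρ + 1) B
    rcases le_or_gt (A.card : ℝ) X with hAX | hAX
    · exact main (ρ + 1) A B hAn hB hAX
    have hpot := h.resolve_left (not_le.2 hAX)
    push_cast at hpot
    have hA0 : (0 : ℝ) < A.card := by linarith
    have hAne : A.Nonempty := Finset.card_pos.1 (by exact_mod_cast hA0)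
    set d := D / 2 * A.card with hd
    set H := highDegree A B d with hH
    have hHA : H ⊆ A := Finset.filter_subset _ _
    have hHcard : d ≤ H.card := le_card_highDegree hAne (hsat A B hB hAX) hD.le
    set W := (M * (Real.exp 1 * Real.exp 1 * (n : ℝ) ^ q) ^ ρ) * (n : ℝ) ^ ((m - B.card) / r)
      with hW
    have hW0 : 0 ≤ W := hnonneg ρ B
    have hqA : (q : ℝ) ≤ D / 4 * A.card := hqX.trans (by nlinarith)
    have hround : ∀ F ∈ H.powerset.filter fun F => F.card ≤ q,
        ((roundFamily A B s m H q r F).card : ℝ) ≤ Real.exp 1 * W := by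
      intro F hF
      obtain ⟨hFH, hFq⟩ := Finset.mem_filter.1 hF
      rw [Finset.mem_powerset] at hFH
      rcases lt_or_ge F.card q with hlt | hge
      · rw [roundFamily, if_pos hlt]
        have hsub : (A \ H) ∪ F ⊆ A := Finset.union_subset Finset.sdiff_subset (hFH.trans hHA)
        have hcard : (((A \ H) ∪ F).card : ℝ) ≤ (1 - D / 8) * A.card := by
          have h1 : (((A \ H) ∪ F).card : ℝ) ≤ (A \ H).card + F.card := by
            exact_mod_cast Finset.card_union_le _ _
          have h2 : ((A \ H).card : ℝ) + H.card = A.card := by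
            exact_mod_cast Finset.card_sdiff_add_card_eq_card hHA
          have h3 : (F.card : ℝ) ≤ q := by exact_mod_cast hFq
          nlinarith
        have h1 := ih ((A \ H) ∪ F) B ((Finset.card_le_card hsub).trans hAn) (by
          rcases le_or_gt ((((A \ H) ∪ F).card : ℝ)) X with hX' | hX'
          · exact Or.inl hX'
          · right
            have := roundPotential_le_sub_one hD hm hmX hAX hX' hsub (subset_refl B)
              (Or.inl hcard)
            linarith)
        refine h1.trans (le_mul_of_one_le_left hW0 (Real.one_le_exp zero_le_one))
      · have hFq' : F.card = q := le_antisymm hFq hge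
        rw [roundFamily, if_neg (by omega)]
        have hT : ∀ T ∈ A.powerset.filter fun T => r * T.card ≤ ((T + F) \ B).card,
            ((sandwichedSets (lowDegree A F (B ∪ (T + F)) r) (B ∪ (T + F)) s m).card : ℝ) ≤
              W * (n : ℝ)⁻¹ ^ T.card := by
          intro T hT
          obtain ⟨-, hTr⟩ := Finset.mem_filter.1 hT
          set B' := B ∪ (T + F) with hB'
          set A' := lowDegree A F B' r with hA'
          have hsub : A' ⊆ A := Finset.filter_subset _ _
          have hBB' : B ⊆ B' := Finset.subset_union_left
          have hB'card : (B'.card : ℝ) = ((T + F) \ B).card + B.card := by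
            have := Finset.card_sdiff_add_card (T + F) B
            rw [Finset.union_comm] at this
            exact_mod_cast this.symm
          have hB'B : ((B' \ B).card : ℝ) + B.card = B'.card := by
            exact_mod_cast Finset.card_sdiff_add_card_eq_card hBB'
          have hprog : (A'.card : ℝ) ≤ (1 - D / 8) * A.card ∨
              B.card + D / 4 * A.card ≤ (B'.card : ℝ) := by
            -- Otherwise the three sources supply less than `D/8 + D/8 + D/4 = D/2` times `q|A|`,
            -- contradicting the high degrees in `F`.
            by_contra! hcon
            have h1 := card_mul_degree_le (B' := B') hr0.le hFH
            rw [hFq', ← hA', hd, hr] at h1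
            have h2 : (q : ℝ) * (D / 2 * A.card) ≤ q * (D / 8 * A.card +
                (A.card - A'.card) + (B' \ B).card) := by linarith
            have h3 := le_of_mul_le_mul_left h2 hq0
            linarith [hcon.1, hcon.2]
          have h1 := ih A' B' ((Finset.card_le_card hsub).trans hAn) (by
            rcases le_or_gt (A'.card : ℝ) X with hX' | hX'
            · exact Or.inl hX'
            · right
              have := roundPotential_le_sub_one hD hm hmX hAX hX' hsub hBB' hprog
              linarith)
          refine h1.trans ?_
          have hsplit : W * (n : ℝ)⁻¹ ^ T.card =
              (M * (Real.exp 1 * Real.exp 1 * (n : ℝ) ^ q) ^ ρ) *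
                ((n : ℝ) ^ ((m - B.card) / r) * (n : ℝ)⁻¹ ^ T.card) := by rw [hW, mul_assoc]
          rw [hsplit]
          refine mul_le_mul_of_nonneg_left ?_ (by positivity)
          -- As `|B'| ≥ |B| + r|T|`, the exponent `(m - |B|)/r` drops by at least `|T|`.
          rw [inv_pow, ← div_eq_mul_inv, ← Real.rpow_sub_natCast hn0.ne']
          refine Real.rpow_le_rpow_of_exponent_le hn1 ?_
          rw [div_le_iff₀ hr0, sub_mul, div_mul_cancel₀ _ hr0.ne', hB'card]
          linarith
        calc (((A.powerset.filter fun T => r * T.card ≤ ((T + F) \ B).card).biUnion fun T =>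
              sandwichedSets (lowDegree A F (B ∪ (T + F)) r) (B ∪ (T + F)) s m).card : ℝ)
            ≤ ∑ T ∈ A.powerset.filter fun T => r * T.card ≤ ((T + F) \ B).card,
              ((sandwichedSets (lowDegree A F (B ∪ (T + F)) r) (B ∪ (T + F)) s m).card : ℝ) := by
              exact_mod_cast Finset.card_biUnion_le
          _ ≤ ∑ T ∈ A.powerset.filter fun T => r * T.card ≤ ((T + F) \ B).card,
              W * (n : ℝ)⁻¹ ^ T.card := Finset.sum_le_sum hT
          _ ≤ ∑ T ∈ A.powerset, W * (n : ℝ)⁻¹ ^ T.card :=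
              Finset.sum_le_sum_of_subset_of_nonneg (Finset.filter_subset _ _)
                fun _ _ _ => mul_nonneg hW0 (by positivity)
          _ ≤ Real.exp 1 * W := by
              rw [← Finset.mul_sum, mul_comm]
              exact mul_le_mul_of_nonneg_right (sum_powerset_inv_pow_le A hn hAn) hW0
    calc ((sandwichedSets A B s m).card : ℝ)
        ≤ (((H.powerset.filter fun F => F.card ≤ q).biUnion
            (roundFamily A B s m H q r)).card : ℝ) := by
          exact_mod_cast Finset.card_le_card (sandwichedSets_subset_biUnion A B s m H q hr0)
      _ ≤ ∑ F ∈ H.powerset.filter fun F => F.card ≤ q,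
            ((roundFamily A B s m H q r F).card : ℝ) := by
          exact_mod_cast Finset.card_biUnion_le
      _ ≤ ∑ F ∈ H.powerset.filter fun F => F.card ≤ q, Real.exp 1 * W := Finset.sum_le_sum hround
      _ = ((H.powerset.filter fun F => F.card ≤ q).card : ℝ) * (Real.exp 1 * W) := by
          rw [Finset.sum_const, nsmul_eq_mul]
      _ ≤ (Real.exp 1 * (n : ℝ) ^ q) * (Real.exp 1 * W) :=
          mul_le_mul_of_nonneg_right
            (card_powerset_filter_le H hn ((Finset.card_le_card hHA).trans hAn) q) (by positivity)
      _ = _ := by rw [hW, pow_succ]; ring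

end Counting

/-! ### Choice of parameters -/

section Bounds

lemma le_log_natCast_of_two_le {n : ℕ} (hn : 2 ≤ n) : 0.69 ≤ Real.log n := by
  have h1 := Real.log_two_gt_d9
  have h2 : Real.log 2 ≤ Real.log n := Real.log_le_log (by norm_num) (by exact_mod_cast hn)
  linarith

lemma card_smallDoublingSets_le_choose {G : Type u} [AddCommGroup G] [DecidableEq G]
    (Y : Finset G) (s : ℕ) (K : ℝ) : (smallDoublingSets Y s K).card ≤ Y.card.choose s := by
  rw [← Finset.card_powersetCard]
  exact Finset.card_le_card (Finset.filter_subset _ _)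

lemma smallDoublingSets_subset_sandwichedSets {G : Type u} [AddCommGroup G] [DecidableEq G]
    (Y : Finset G) (s : ℕ) (K : ℝ) : smallDoublingSets Y s K ⊆ sandwichedSets Y ∅ s (K * s) := by
  intro J hJ
  obtain ⟨hJY, hJK⟩ := Finset.mem_filter.1 hJ
  obtain ⟨hJY, hJs⟩ := Finset.mem_powersetCard.1 hJY
  rw [mem_sandwichedSets]
  exact ⟨⟨hJY, hJs⟩, Finset.empty_subset _, by rwa [hJs] at hJK⟩

lemma one_le_ringChoose {x : ℝ} {s : ℕ} (h : (s : ℝ) ≤ x) : 1 ≤ Ring.choose x s := by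
  simpa using natChoose_le_ringChoose h h

/-- Container count for sets of small doubling, in terms of `ε = (K / s) ^ (1 / 6) * √(log n)`. -/
theorem card_smallDoublingSets_le_exp_mul {G : Type u} [AddCommGroup G] [DecidableEq G]
    {n s : ℕ} {K ε : ℝ} (Y : Finset G) (hY : Y.card = n) (hn : 2 ≤ n) (hK : 2 ≤ K)
    (hε0 : 0 < ε) (hε : ε ≤ 1 / 64) (hε6 : ε ^ 6 * s = K * Real.log n ^ 3) :
    ((smallDoublingSets Y s K).card : ℝ) ≤ Real.exp (40 * (ε * s)) *
      Ring.choose ((1 + 2 * ε) *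
        ((K * s + largestSubgroupCard G (K * s + 64 * (ε * (K * s)))) / 2)) s := by
  set L := Real.log n with hL
  have hL1 : 0.69 ≤ L := le_log_natCast_of_two_le hn
  have hL2 : 0.47 ≤ L ^ 2 := by nlinarith
  have hL3 : 0.32 ≤ L ^ 3 := by nlinarith
  have hL0 : 0 < L := by linarith
  have hn0 : (0 : ℝ) < n := by positivity
  have hs0 : (0 : ℝ) ≤ s := Nat.cast_nonneg _
  have hKL : 0.64 ≤ K * L ^ 3 := by nlinarith
  have hε5 : ε ^ 5 ≤ 1 / 64 := by
    calc ε ^ 5 ≤ (1 / 64) ^ 5 := pow_le_pow_left₀ hε0.le hε 5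
      _ ≤ 1 / 64 := by norm_num
  have hεs : 40 ≤ ε * s := by
    have h1 : ε ^ 6 * s = ε ^ 5 * (ε * s) := by ring
    have h2 : 0 ≤ ε * s := by positivity
    have h3 := mul_le_mul_of_nonneg_right hε5 h2
    linarith
  have hs : (0 : ℝ) < s := by
    refine lt_of_le_of_ne hs0 fun h => ?_
    rw [← h] at hεs
    linarith
  have hs8 : 8 ≤ (s : ℝ) := by
    have := mul_le_mul_of_nonneg_right hε hs0
    linarith
  set m := K * s with hm
  have hm0 : 0 < m := by positivity
  have hsm : 2 * s ≤ m := mul_le_mul_of_nonneg_right hK hs0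
  set β : ℝ := (largestSubgroupCard G (m + 64 * (ε * m)) : ℝ) with hβ
  have hβ0 : 0 ≤ β := Nat.cast_nonneg _
  set X := (1 + 2 * ε) * ((m + β) / 2) with hX
  have hmX : m ≤ 2 * X := by
    have : 0 ≤ ε * (m + β) := by positivity
    linarith
  have hsX : (s : ℝ) ≤ X := by linarith
  have hX0 : 0 < X := by linarith
  set D := ε ^ 2 with hD
  have hD0 : 0 < D := by positivity
  have hD1 : D ≤ 1 := pow_le_one₀ hε0.le (by linarith)
  -- The choice of `ε` makes `w = √(m L)`.
  set w := ε ^ 3 * s / L with hw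
  have hw0 : 0 < w := by positivity
  have hwL : L * w = ε ^ 3 * s := by rw [hw]; field_simp
  have hmw : m * L = w ^ 2 := by
    have h1 : L ^ 2 * w ^ 2 = L ^ 2 * (m * L) := by
      calc L ^ 2 * w ^ 2 = (L * w) ^ 2 := by ring
        _ = (ε ^ 6 * s) * s := by rw [hwL]; ring
        _ = L ^ 2 * (m * L) := by rw [hε6, hm]; ring
    exact (mul_left_cancel₀ (by positivity) h1).symm
  have hDw : 16 ≤ D * w := by
    have h1 : ε * (L * (D * w)) = K * L ^ 3 := by
      rw [← hε6, hD]
      calc ε * (L * (ε ^ 2 * w)) = ε ^ 3 * (L * w) := by ring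
        _ = ε ^ 6 * s := by rw [hwL]; ring
    have h2 : ε * (L * 16) ≤ K * L ^ 3 := by
      have : ε * (L * 16) ≤ (1 / 64) * (L * 16) := mul_le_mul_of_nonneg_right hε (by positivity)
      have h3 := mul_le_mul_of_nonneg_right hL2 hL0.le
      have h4 : 2 * L ^ 3 ≤ K * L ^ 3 := mul_le_mul_of_nonneg_right hK (by positivity)
      have h5 : L ^ 3 = L ^ 2 * L := by ring
      linarith
    rw [← h1] at h2
    exact le_of_mul_le_mul_left (le_of_mul_le_mul_left h2 hε0) hL0
  have hw16 : 16 ≤ w := by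
    have := mul_le_mul_of_nonneg_right hD1 hw0.le
    linarith
  -- `q ≈ √(m / L)` balances the cost `q L` of choosing `F` in a round against `m / q`, both of
  -- order `w`.
  set q := ⌈w / L⌉₊ with hq
  have hwLpos : 0 < w / L := by positivity
  have hwL1 : 1 ≤ w / L := by
    have h1 : ε ^ 3 * L * w = K * L ^ 3 := by
      calc ε ^ 3 * L * w = ε ^ 3 * (L * w) := by ring
        _ = ε ^ 6 * s := by rw [hwL]; ring
        _ = _ := hε6
    have h2 : ε ^ 3 ≤ 1 := pow_le_one₀ hε0.le (by linarith)
    have h3 : ε ^ 3 * L * L ≤ K * L ^ 3 := by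
      calc ε ^ 3 * L * L ≤ 1 * L * L := by gcongr
        _ = 1 * L ^ 2 := by ring
        _ ≤ (K * L) * L ^ 2 := mul_le_mul_of_nonneg_right (by
            have := mul_le_mul hK hL1 (by norm_num) (by linarith)
            linarith) (by positivity)
        _ = K * L ^ 3 := by ring
    rw [← h1] at h3
    rw [one_le_div hL0]
    exact le_of_mul_le_mul_left h3 (by positivity)
  have hq1 : 1 ≤ q := Nat.ceil_pos.2 hwLpos
  have hqlo : w / L ≤ q := Nat.le_ceil _
  have hqhi : (q : ℝ) ≤ 2 * (w / L) := by
    have := (Nat.ceil_lt_add_one hwLpos.le).le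
    linarith
  have hqL : w ≤ q * L := (div_le_iff₀ hL0).1 hqlo
  have hqL2 : q * L ≤ 2 * w := by
    have := mul_le_mul_of_nonneg_right hqhi hL0.le
    rwa [mul_assoc, div_mul_cancel₀ _ hL0.ne'] at this
  have hq0 : (0 : ℝ) < q := by exact_mod_cast hq1
  have hqX : (q : ℝ) ≤ D / 4 * X := by
    have h1 : q * L ≤ (D / 8 * m) * L := by
      have : D / 8 * m * L = D * w / 8 * w := by rw [mul_assoc, hmw]; ring
      have h2 := mul_le_mul_of_nonneg_right hDw hw0.le
      rw [this]
      linarith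
    have h2 := le_of_mul_le_mul_right h1 hL0
    have h3 := mul_le_mul_of_nonneg_left hmX hD0.le
    linarith
  have hsat : ∀ A B : Finset G, (B.card : ℝ) ≤ m → X < A.card →
      D * (A.card : ℝ) ^ 2 < ((A ×ˢ A).filter (fun p => p.1 + p.2 ∉ B)).card := by
    intro A B hB hA
    have h1 := mul_le_mul_of_nonneg_left hsm hε0.le
    exact supersaturation A B hm0 hε0 hε (by linarith) hB hA
  set M := Ring.choose X s with hM
  have hM0 : 0 ≤ M := (Ring.choose_pos_of_le hsX).le
  obtain ⟨ρ, hρ, hρL⟩ : ∃ ρ : ℕ, ((Y.card : ℝ) ≤ X ∨ roundPotential Y ∅ X m D ≤ ρ) ∧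
      (ρ : ℝ) ≤ 8 / D * L := by
    rcases le_or_gt (Y.card : ℝ) X with h | h
    · exact ⟨0, Or.inl h, by simp; positivity⟩
    · refine ⟨⌈roundPotential Y ∅ X m D⌉₊, Or.inr (Nat.le_ceil _), ?_⟩
      have hlog : 0 < Real.log (Y.card / X) := Real.log_pos ((one_lt_div hX0).2 h)
      have hpot : roundPotential Y ∅ X m D = 8 / D * (Real.log (Y.card / X) + 1) := by
        unfold roundPotential
        simp only [Finset.card_empty, Nat.cast_zero, sub_zero]
        field_simp
      have h1 := (Nat.ceil_lt_add_one (a := roundPotential Y ∅ X m D)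
        (by rw [hpot]; positivity)).le
      -- The saving `log X ≥ 2` absorbs both the linear term of the initial potential and the
      -- rounding up of `ρ`.
      have hX2 : 2 ≤ Real.log X := by
        rw [Real.le_log_iff_exp_le hX0]
        have h2 := Real.exp_one_lt_d9
        have h3 : Real.exp 2 = Real.exp 1 * Real.exp 1 := by rw [← Real.exp_add]; norm_num
        have h4 := Real.exp_pos 1
        have h5 := mul_lt_mul'' h2 h2 h4.le h4.le
        linarith
      have h2 : 1 ≤ 8 / D := (one_le_div hD0).2 (by linarith)
      refine h1.trans ?_
      rw [hpot, hY, Real.log_div hn0.ne' hX0.ne', ← hL]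
      have h3 := mul_le_mul_of_nonneg_left hX2 (by positivity : 0 ≤ 8 / D)
      linarith
  have hmain := card_sandwichedSets_le (n := n) (s := s) (q := q) (by omega) hq1 hD0 hm0 hmX hqX
    hM0 hsat (fun a ha => natChoose_le_ringChoose hsX ha) ρ Y ∅ hY.le hρ
  have hle : ((smallDoublingSets Y s K).card : ℝ) ≤ (sandwichedSets Y ∅ s m).card := by
    exact_mod_cast Finset.card_le_card (smallDoublingSets_subset_sandwichedSets Y s K)
  refine hle.trans (hmain.trans ?_)
  have e1 : (Real.exp 1 * Real.exp 1 * (n : ℝ) ^ q) ^ ρ = Real.exp (ρ * (2 + q * L)) := by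
    rw [← Real.exp_log hn0, ← hL, ← Real.exp_nat_mul, ← Real.exp_add, ← Real.exp_add,
      ← Real.exp_nat_mul]
    norm_num
  have e2 : (n : ℝ) ^ ((m - (∅ : Finset G).card) / (D * q / 8)) =
      Real.exp (8 / D * L * (m / q)) := by
    rw [Real.rpow_def_of_pos hn0, ← hL]
    congr 1
    simp only [Finset.card_empty, Nat.cast_zero, sub_zero]
    field_simp
  rw [e1, e2, mul_assoc, ← Real.exp_add, mul_comm]
  refine mul_le_mul_of_nonneg_right (Real.exp_le_exp.2 ?_) hM0
  have h1 : 2 + q * L ≤ 4 * w := by linarith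
  have h2 : m / q ≤ w := by
    rw [div_le_iff₀ hq0]
    have : m * L ≤ w * q * L := by
      have := mul_le_mul_of_nonneg_left hqL hw0.le
      rw [hmw]; linarith
    exact le_of_mul_le_mul_right this hL0
  have h3 : 0 ≤ 8 / D * L := by positivity
  have h4 : (ρ : ℝ) * (2 + q * L) ≤ 8 / D * L * (4 * w) :=
    mul_le_mul hρL h1 (by positivity) h3
  have h5 : 8 / D * L * (m / q) ≤ 8 / D * L * w := mul_le_mul_of_nonneg_left h2 h3
  have h6 : 8 / D * L * (4 * w) + 8 / D * L * w = 40 * (ε * s) := by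
    calc 8 / D * L * (4 * w) + 8 / D * L * w = 40 / D * (L * w) := by ring
      _ = _ := by rw [hwL, hD]; field_simp
  linarith

end Bounds

/-! ### The explicit and asymptotic bounds -/

section MainBounds

lemma card_smallDoublingSets_le_choose_of_le_one {G : Type u} [AddCommGroup G] [DecidableEq G]
    {n s : ℕ} {K x : ℝ} (Y : Finset G) (hY : Y.card = n) (hn : n ≤ 1) (hx : (s : ℝ) ≤ x) :
    ((smallDoublingSets Y s K).card : ℝ) ≤ Ring.choose x s := by
  have h1 := card_smallDoublingSets_le_choose Y s K
  have h2 : Y.card.choose s ≤ 1 := by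
    calc Y.card.choose s ≤ Nat.choose 1 s := Nat.choose_le_choose s (by omega)
      _ ≤ 1 := by rcases s with _ | _ | s <;> simp [Nat.choose]
  have h3 : ((smallDoublingSets Y s K).card : ℝ) ≤ 1 := by exact_mod_cast h1.trans h2
  exact h3.trans (one_le_ringChoose hx)

lemma le_half_mul_add {s : ℕ} {K β : ℝ} (hK : 2 ≤ K) (hβ : 0 ≤ β) :
    (s : ℝ) ≤ (K * s + β) / 2 := by
  have := mul_le_mul_of_nonneg_right hK (Nat.cast_nonneg s : (0 : ℝ) ≤ s)
  linarith

lemma rpow_sixth_pow {K s : ℝ} {L : ℝ} (hK : 0 ≤ K) (hs : 0 < s) (hL : 0 ≤ L) :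
    ((K / s) ^ (1 / 6 : ℝ) * √L) ^ 6 * s = K * L ^ 3 := by
  have h1 : ((K / s) ^ (1 / 6 : ℝ)) ^ 6 = K / s := by
    rw [← Real.rpow_natCast, ← Real.rpow_mul (by positivity)]
    norm_num
  have h2 : (√L) ^ 6 = L ^ 3 := by
    calc (√L) ^ 6 = ((√L) ^ 2) ^ 3 := by ring
      _ = _ := by rw [Real.sq_sqrt hL]
  rw [mul_pow, h1, h2]
  field_simp

lemma rpow_sixth_mul {K s : ℝ} (L : ℝ) (hK : 0 ≤ K) (hs : 0 < s) :
    (K / s) ^ (1 / 6 : ℝ) * √L * s = K ^ (1 / 6 : ℝ) * s ^ (5 / 6 : ℝ) * √L := by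
  have h1 : s = s ^ (1 / 6 : ℝ) * s ^ (5 / 6 : ℝ) := by
    rw [← Real.rpow_add hs]; norm_num
  have h2 : s ^ (1 / 6 : ℝ) ≠ 0 := (Real.rpow_pos_of_pos hs _).ne'
  rw [Real.div_rpow hK hs.le]
  conv_lhs => rw [mul_assoc, mul_comm (√L), ← mul_assoc]
  congr 1
  conv_lhs => rhs; rw [h1]
  field_simp

/-- The explicit bound. -/
theorem card_smallDoublingSets_le_exp_lambda {G : Type u} [AddCommGroup G] [DecidableEq G]
    {n s : ℕ} {K : ℝ} (Y : Finset G) (hY : Y.card = n) (hK : 2 ≤ K)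
    (hs : K * Real.log n ^ 3 < 2⁻¹ ^ 36 * (s : ℝ)) :
    ((smallDoublingSets Y s K).card : ℝ) ≤
      Real.exp (2 ^ 9 * doublingLambda K s * K ^ (1 / 6 : ℝ) * (s : ℝ) ^ (5 / 6 : ℝ)
          * √(Real.log n)) *
        Ring.choose ((K * s + (largestSubgroupCard G
          (K * s + 2 ^ 6 * K ^ (7 / 6 : ℝ) * (s : ℝ) ^ (5 / 6 : ℝ) * √(Real.log n)) : ℝ)) / 2)
          s := by
  rcases le_or_gt n 1 with hn | hn
  · have h0 : Real.log n = 0 := by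
      rcases (by omega : n = 0 ∨ n = 1) with rfl | rfl <;> simp
    rw [h0, Real.sqrt_zero, mul_zero, Real.exp_zero, one_mul]
    exact card_smallDoublingSets_le_choose_of_le_one Y hY hn
      (le_half_mul_add hK (Nat.cast_nonneg _))
  have hL : 0.69 ≤ Real.log n := le_log_natCast_of_two_le hn
  set L := Real.log n
  have hL0 : 0 < L := by linarith
  have hK0 : 0 < K := by linarith
  have hs0 : (0 : ℝ) < s := by
    have : 0 < K * L ^ 3 := by positivity
    have h2 : (0 : ℝ) < 2⁻¹ ^ 36 * s := this.trans hs
    exact pos_of_mul_pos_right h2 (by positivity)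
  set ε := (K / s) ^ (1 / 6 : ℝ) * √L with hεdef
  have hε0 : 0 < ε := mul_pos (Real.rpow_pos_of_pos (by positivity) _) (Real.sqrt_pos.2 hL0)
  have hε6 : ε ^ 6 * s = K * L ^ 3 := rpow_sixth_pow hK0.le hs0 hL0.le
  have hεs : ε * s = K ^ (1 / 6 : ℝ) * (s : ℝ) ^ (5 / 6 : ℝ) * √L := rpow_sixth_mul L hK0.le hs0
  -- This is where `2^(-36) = (1/64)^6` enters.
  have hε : ε ≤ 1 / 64 := by
    have h1 : ε ^ 6 < (1 / 64) ^ 6 := by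
      rw [← hε6] at hs
      have := lt_of_mul_lt_mul_right hs hs0.le
      norm_num at this ⊢
      exact this
    exact (lt_of_pow_lt_pow_left₀ 6 (by norm_num) h1).le
  have hT : K * s + 2 ^ 6 * K ^ (7 / 6 : ℝ) * (s : ℝ) ^ (5 / 6 : ℝ) * √L =
      K * s + 64 * (ε * (K * s)) := by
    have h1 : K ^ (7 / 6 : ℝ) = K * K ^ (1 / 6 : ℝ) := by
      rw [show (7 / 6 : ℝ) = 1 + 1 / 6 by norm_num, Real.rpow_add hK0, Real.rpow_one]
    have h2 : ε * (K * s) = K * (ε * s) := by ring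
    rw [h1, h2, hεs]
    ring
  have hcore := card_smallDoublingSets_le_exp_mul Y hY hn hK hε0 hε hε6
  rw [hT]
  have hexp : 2 ^ 9 * doublingLambda K s * K ^ (1 / 6 : ℝ) * (s : ℝ) ^ (5 / 6 : ℝ) * √L =
      2 ^ 9 * doublingLambda K s * (ε * s) := by rw [hεs]; ring
  rw [hexp]
  have hs8 : 8 ≤ (s : ℝ) := by
    have h1 : L ^ 3 ≥ 0.69 ^ 3 := pow_le_pow_left₀ (by norm_num) hL 3
    have h2 : 2 * 0.69 ^ 3 ≤ K * L ^ 3 := mul_le_mul hK h1 (by norm_num) hK0.le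
    norm_num at h2 hs
    linarith
  have hm2 : 2 * (s : ℝ) ≤ K * s := mul_le_mul_of_nonneg_right hK hs0.le
  -- The trivial subgroup gives `β ≥ 1`, hence `x > s` strictly.
  have hβ1 : (1 : ℝ) ≤ largestSubgroupCard G (K * s + 64 * (ε * (K * s))) := by
    have : 0 ≤ 64 * (ε * (K * s)) := by positivity
    exact_mod_cast one_le_largestSubgroupCard (by linarith)
  set β : ℝ := (largestSubgroupCard G (K * s + 64 * (ε * (K * s))) : ℝ)
  set x := (K * s + β) / 2 with hx
  have hsx : (s : ℝ) < x := by linarith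
  have hx0 : 0 < x := by linarith
  have hX : (1 + 2 * ε) * x = x + 2 * ε * x := by ring
  rw [hX] at hcore
  have hpos : 0 < Ring.choose x s := Ring.choose_pos_of_le hsx.le
  have hεs0 : 0 < ε * s := by positivity
  -- The container cost `40 ε s` and the binomial loss `4 μ ε s` fit together into `2^9 μ ε s`.
  have key : ∀ μ, 1 ≤ μ →
      Ring.choose (x + 2 * ε * x) s ≤ Real.exp (4 * μ * (ε * s)) * Ring.choose x s →
      ((smallDoublingSets Y s K).card : ℝ) ≤
        Real.exp (2 ^ 9 * μ * (ε * s)) * Ring.choose x s := by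
    intro μ hμ h
    refine hcore.trans ((mul_le_mul_of_nonneg_left h (Real.exp_pos _).le).trans ?_)
    rw [← mul_assoc, ← Real.exp_add]
    refine mul_le_mul_of_nonneg_right (Real.exp_le_exp.2 ?_) hpos.le
    have : ε * s ≤ μ * (ε * s) := le_mul_of_one_le_left hεs0.le hμ
    linarith
  have hlog : 1 ≤ Real.log s := by
    rw [Real.le_log_iff_exp_le hs0]
    have := Real.exp_one_lt_d9
    linarith
  have keylog := key (Real.log s) hlog (by
    refine (ringChoose_mul_le_exp_log hsx.le (by positivity : 0 ≤ 2 * ε)).trans ?_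
    refine mul_le_mul_of_nonneg_right (Real.exp_le_exp.2 ?_) hpos.le
    have := mul_le_mul_of_nonneg_left hlog hεs0.le
    linarith)
  unfold doublingLambda
  split_ifs with hK2
  · exact keylog
  rcases min_choice (K / (K - 2)) (Real.log s) with hmin | hmin
  · rw [hmin]
    have hK2' : 0 < K - 2 := sub_pos.2 (lt_of_le_of_ne hK (Ne.symm hK2))
    have hμ1 : 1 ≤ K / (K - 2) := (one_le_div hK2').2 (by linarith)
    refine key _ hμ1 ?_
    refine (ringChoose_mul_le_exp_div hsx (by positivity : 0 ≤ 2 * ε)).trans ?_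
    refine mul_le_mul_of_nonneg_right (Real.exp_le_exp.2 ?_) hpos.le
    have h1 : x / (x - s) ≤ K / (K - 2) := by
      rw [div_le_div_iff₀ (by linarith) hK2']
      linarith
    have h2 := mul_le_mul_of_nonneg_left h1 hεs0.le
    have h3 : 0 ≤ ε * s * (K / (K - 2)) := by positivity
    linarith
  · rw [hmin]
    exact keylog

/-- The asymptotic bound, uniform over all abelian groups. -/
theorem exists_card_smallDoublingSets_le_two_rpow {δ : ℝ} (hδ : 0 < δ) : ∃ c : ℝ, 0 < c ∧
    ∀ (G : Type u) [AddCommGroup G] [DecidableEq G] (n s : ℕ) (K : ℝ) (Y : Finset G),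
      Y.card = n → 1 ≤ s → 2 ≤ K → K * Real.log n ^ 3 ≤ c * (s : ℝ) →
      ((smallDoublingSets Y s K).card : ℝ) ≤
        (2 : ℝ) ^ (δ * s) *
          Ring.choose ((K * s + (largestSubgroupCard G ((1 + δ) * (K * s)) : ℝ)) / 2) s := by
  -- The binomial loss is `exp(2 s √(2ε))`, so `ε ≤ θ²/2` yields `√(2ε) ≤ θ`; since `ε^6 = K (log
  -- n)^3 / s`, the constant is `c = (θ²/2)^6`.
  set θ := min (δ / 64) (1 / 64) with hθ
  have hθ0 : 0 < θ := lt_min (by positivity) (by norm_num)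
  have hθδ : θ ≤ δ / 64 := min_le_left _ _
  have hθ1 : θ ≤ 1 / 64 := min_le_right _ _
  have hθsq : θ ^ 2 ≤ θ / 64 := by nlinarith
  set η := θ ^ 2 / 2 with hη
  have hη0 : 0 < η := by positivity
  refine ⟨η ^ 6, by positivity, ?_⟩
  intro G _ _ n s K Y hY hs hK hc
  have hs0 : (0 : ℝ) < s := by exact_mod_cast hs
  have hK0 : 0 < K := by linarith
  set x := (K * s + (largestSubgroupCard G ((1 + δ) * (K * s)) : ℝ)) / 2 with hx
  have hsx : (s : ℝ) ≤ x := le_half_mul_add hK (Nat.cast_nonneg _)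
  have hx0 : 0 < x := by linarith
  have hpos : 0 < Ring.choose x s := Ring.choose_pos_of_le hsx
  have h2rpow : (2 : ℝ) ^ (δ * s) = Real.exp (Real.log 2 * (δ * s)) :=
    Real.rpow_def_of_pos (by norm_num) _
  have hlog2 := Real.log_two_gt_d9
  rcases le_or_gt n 1 with hn | hn
  · refine (card_smallDoublingSets_le_choose_of_le_one Y hY hn hsx).trans
      (le_mul_of_one_le_left hpos.le ?_)
    exact Real.one_le_rpow (by norm_num) (by positivity)
  have hL : 0.69 ≤ Real.log n := le_log_natCast_of_two_le hn
  have hL0 : 0 < Real.log n := by linarith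
  set ε := (K / s) ^ (1 / 6 : ℝ) * √(Real.log n) with hεdef
  have hε0 : 0 < ε := mul_pos (Real.rpow_pos_of_pos (by positivity) _) (Real.sqrt_pos.2 hL0)
  have hε6 : ε ^ 6 * s = K * Real.log n ^ 3 := rpow_sixth_pow hK0.le hs0 hL0.le
  have hεη : ε ≤ η := by
    rw [← hε6] at hc
    exact le_of_pow_le_pow_left₀ (by norm_num) hη0.le (le_of_mul_le_mul_right hc hs0)
  have hcore := card_smallDoublingSets_le_exp_mul Y hY hn hK hε0 (by linarith) hε6
  have hms : 2 * (s : ℝ) ≤ K * s := mul_le_mul_of_nonneg_right hK hs0.le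
  have hs1 : (1 : ℝ) ≤ s := by exact_mod_cast hs
  have hm0 : 0 < K * s := by positivity
  have hβ : (largestSubgroupCard G (K * s + 64 * (ε * (K * s))) : ℝ) ≤
      largestSubgroupCard G ((1 + δ) * (K * s)) := by
    have h1 : 0 ≤ 64 * (ε * (K * s)) := by positivity
    have h2 : 64 * ε ≤ δ := by linarith
    have h3 := mul_le_mul_of_nonneg_right h2 hm0.le
    exact_mod_cast largestSubgroupCard_mono (by linarith) (by linarith)
  have hX : (1 + 2 * ε) * ((K * s + largestSubgroupCard G (K * s + 64 * (ε * (K * s)))) / 2) ≤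
      x + 2 * ε * x := by
    calc _ ≤ (1 + 2 * ε) * x := mul_le_mul_of_nonneg_left (by linarith) (by positivity)
      _ = _ := by ring
  have hX' : (s : ℝ) ≤
      (1 + 2 * ε) * ((K * s + largestSubgroupCard G (K * s + 64 * (ε * (K * s)))) / 2) := by
    have h1 := le_half_mul_add (s := s) hK
      (Nat.cast_nonneg (largestSubgroupCard G (K * s + 64 * (ε * (K * s)))))
    exact h1.trans (le_mul_of_one_le_left (hs0.le.trans h1) (by linarith))
  have hratio := ringChoose_add_le_exp_sqrt hsx hs (by positivity : 0 ≤ 2 * ε * x)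
  rw [mul_div_cancel_right₀ _ hx0.ne'] at hratio
  have hsqrt : √(2 * ε) ≤ θ := by
    rw [Real.sqrt_le_left hθ0.le]
    linarith
  refine hcore.trans ((mul_le_mul_of_nonneg_left
    ((Ring.choose_le_choose_of_le hX' hX).trans hratio) (Real.exp_pos _).le).trans ?_)
  rw [← mul_assoc, ← Real.exp_add, h2rpow]
  refine mul_le_mul_of_nonneg_right (Real.exp_le_exp.2 ?_) hpos.le
  have h1 : 40 * ε + 2 * √(2 * ε) ≤ Real.log 2 * δ := by
    have h3 : 0.69 * δ ≤ Real.log 2 * δ := mul_le_mul_of_nonneg_right (by linarith) hδ.le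
    linarith
  have h2 := mul_le_mul_of_nonneg_right h1 hs0.le
  linarith

lemma largestSubgroupCard_int_le_one (t : ℝ) : largestSubgroupCard ℤ t ≤ 1 := by
  unfold largestSubgroupCard
  rcases Set.eq_empty_or_nonempty
    {k : ℕ | ∃ H : AddSubgroup ℤ, Finite H ∧ Nat.card H = k ∧ (k : ℝ) ≤ t} with h | h
  · rw [h]; simp
  · refine csSup_le h ?_
    rintro k ⟨H, hf, rfl, -⟩
    -- A non-zero integer has infinitely many distinct multiples, so a finite subgroup of `ℤ` is
    -- trivial.
    have : H = ⊥ := by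
      rw [eq_bot_iff]
      intro a ha
      by_contra hne
      have hinj : Function.Injective (fun j : ℕ => (⟨j • a, H.nsmul_mem ha j⟩ : H)) := by
        intro i j hij
        simp only [Subtype.mk.injEq, nsmul_eq_mul] at hij
        have := mul_right_cancel₀ (fun h0 => hne (by simp [h0])) hij
        exact_mod_cast this
      exact not_injective_infinite_finite _ hinj
    rw [this]
    simp

/-- The asymptotic bound for subsets of `{1, …, n}`. -/
theorem exists_card_smallDoublingSets_Icc_le {δ : ℝ} (hδ : 0 < δ) : ∃ c : ℝ, 0 < c ∧
    ∀ (n s : ℕ) (K : ℝ), 1 ≤ s → 2 ≤ K → K * Real.log n ^ 3 ≤ c * (s : ℝ) →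
      ((smallDoublingSets (Finset.Icc (1 : ℤ) n) s K).card : ℝ) ≤
        (2 : ℝ) ^ (δ * s) * Ring.choose (K * s / 2) s := by
  obtain ⟨c, hc0, hc⟩ := exists_card_smallDoublingSets_le_two_rpow.{0} (half_pos hδ)
  -- Half of `δ` goes to the general bound. The rest pays for removing `β ≤ 1`, at cost `exp(2 s √(1
  -- / (K s)))`; the entry `(δ/8)²` forces `√(1 / (K s)) ≤ δ/8`.
  refine ⟨min c ((δ / 8) ^ 2), lt_min hc0 (by positivity), ?_⟩
  intro n s K hs hK h
  have hs0 : (0 : ℝ) < s := by exact_mod_cast hs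
  have hK0 : 0 < K := by linarith
  have hcard : (Finset.Icc (1 : ℤ) n).card = n := by simp
  have hsx : (s : ℝ) ≤ K * s / 2 := by simpa using le_half_mul_add (s := s) hK le_rfl
  have hx0 : 0 < K * s / 2 := by positivity
  have hpos : 0 < Ring.choose (K * s / 2) s := Ring.choose_pos_of_le hsx
  rcases le_or_gt n 1 with hn | hn
  · refine (card_smallDoublingSets_le_choose_of_le_one _ hcard hn hsx).trans
      (le_mul_of_one_le_left hpos.le ?_)
    exact Real.one_le_rpow (by norm_num) (by positivity)
  have hL : 0.69 ≤ Real.log n := le_log_natCast_of_two_le hn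
  have h1 := hc ℤ n s K _ hcard hs hK
    (h.trans (mul_le_mul_of_nonneg_right (min_le_left _ _) hs0.le))
  have hβ : (largestSubgroupCard ℤ ((1 + δ / 2) * (K * s)) : ℝ) ≤ 1 := by
    exact_mod_cast largestSubgroupCard_int_le_one _
  have h2 : Ring.choose ((K * s + (largestSubgroupCard ℤ ((1 + δ / 2) * (K * s)) : ℝ)) / 2) s ≤
      Ring.choose (K * s / 2 + 1 / 2) s :=
    Ring.choose_le_choose_of_le (le_half_mul_add hK (Nat.cast_nonneg _)) (by linarith)
  have h3 := ringChoose_add_le_exp_sqrt hsx hs (by norm_num : (0 : ℝ) ≤ 1 / 2)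
  have h4 : √(1 / 2 / (K * s / 2)) ≤ δ / 8 := by
    rw [Real.sqrt_le_left (by positivity), div_div_eq_mul_div, div_le_iff₀ (by positivity)]
    have h5 : K * Real.log n ^ 3 ≤ (δ / 8) ^ 2 * s :=
      h.trans (mul_le_mul_of_nonneg_right (min_le_right _ _) hs0.le)
    have h6 : (0.69 : ℝ) ^ 3 ≤ Real.log n ^ 3 := pow_le_pow_left₀ (by norm_num) hL 3
    have h7 : K * 0.69 ^ 3 ≤ K * Real.log n ^ 3 := mul_le_mul_of_nonneg_left h6 hK0.le
    have h8 : 2 * ((δ / 8) ^ 2 * s) ≤ K * ((δ / 8) ^ 2 * s) :=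
      mul_le_mul_of_nonneg_right hK (by positivity)
    norm_num at h7 ⊢
    linarith
  refine h1.trans ((mul_le_mul_of_nonneg_left (h2.trans h3) (by positivity)).trans ?_)
  rw [← mul_assoc, Real.rpow_def_of_pos (by norm_num), Real.rpow_def_of_pos (by norm_num),
    ← Real.exp_add]
  refine mul_le_mul_of_nonneg_right (Real.exp_le_exp.2 ?_) hpos.le
  have hlog2 := Real.log_two_gt_d9
  have h5 : 2 * (s : ℝ) * √(1 / 2 / (K * s / 2)) ≤ 2 * s * (δ / 8) :=
    mul_le_mul_of_nonneg_left h4 (by positivity)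
  have h6 : 0.5 * (δ * s) ≤ Real.log 2 * (δ * s) :=
    mul_le_mul_of_nonneg_right (by linarith) (by positivity)
  linarith

end MainBounds

theorem theorem4p1 :
    -- the explicit bound, for every abelian group
    (∀ (G : Type u) [AddCommGroup G] [DecidableEq G] (n s : ℕ) (K : ℝ) (Y : Finset G),
      Y.card = n → 2 ≤ K → K * Real.log n ^ 3 < 2⁻¹ ^ 36 * (s : ℝ) →
      ((smallDoublingSets Y s K).card : ℝ) ≤
        Real.exp (2 ^ 9 * doublingLambda K s * K ^ (1 / 6 : ℝ) * (s : ℝ) ^ (5 / 6 : ℝ)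
            * √(Real.log n)) *
          Ring.choose ((K * s + (largestSubgroupCard G
            (K * s + 2 ^ 6 * K ^ (7 / 6 : ℝ) * (s : ℝ) ^ (5 / 6 : ℝ) * √(Real.log n)) : ℝ)) / 2)
            s) ∧
    -- the asymptotic form when `K = o(s / (log n)^3)`, uniformly over all abelian groups
    (∀ δ : ℝ, 0 < δ → ∃ c : ℝ, 0 < c ∧
      ∀ (G : Type u) [AddCommGroup G] [DecidableEq G] (n s : ℕ) (K : ℝ) (Y : Finset G),
        Y.card = n → 1 ≤ s → 2 ≤ K → K * Real.log n ^ 3 ≤ c * (s : ℝ) →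
        ((smallDoublingSets Y s K).card : ℝ) ≤
          (2 : ℝ) ^ (δ * s) *
            Ring.choose ((K * s + (largestSubgroupCard G ((1 + δ) * (K * s)) : ℝ)) / 2) s) ∧
    -- the asymptotic form for subsets of `{1, …, n}`
    (∀ δ : ℝ, 0 < δ → ∃ c : ℝ, 0 < c ∧
      ∀ (n s : ℕ) (K : ℝ), 1 ≤ s → 2 ≤ K → K * Real.log n ^ 3 ≤ c * (s : ℝ) →
        ((smallDoublingSets (Finset.Icc (1 : ℤ) n) s K).card : ℝ) ≤
          (2 : ℝ) ^ (δ * s) * Ring.choose (K * s / 2) s) := by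
  refine ⟨?_, fun δ hδ => exists_card_smallDoublingSets_le_two_rpow hδ,
    fun δ hδ => exists_card_smallDoublingSets_Icc_le hδ⟩
  intro G _ _ n s K Y hY hK hs
  exact card_smallDoublingSets_le_exp_lambda Y hY hK hs
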